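/- Let $d\ge 2$, $n=d+2$, $0<\alpha<n$, $1<q\le n/\alpha$ and $q'=q/(q-1)$. Write points of $\mathbb R^{d+1}=\mathbb R^d\times\mathbb R$ as $z=(x,t)$. **Bessel energy and capacity.** Let $$\mathscr G_\alpha(x,t)=(4\pi)^{-d/2}\,\Gamma(\alpha/2)^{-1}\,t^{-\frac{n-\alpha}{2}}\,e^{-t-\frac{|x|^2}{4t}}\quad(t>0),\qquad \mathscr G_\alpha(x,t)=0\quad(t\le 0).$$ For a (nonnegative) Radon measure $\mu$ on $\mathbb R^{d+1}$ put $\check{\mathscr G}_\alpha\mu(w)=\int \mathscr G_\alpha(z-w)\,d\mu(z)$ and $\mathrm E_{\alpha,q}\mu=\int_{\mathbb R^{d+1}}(\check{\mathscr G}_\alpha\mu)^{q'}\,dx\,dt$. For $A\subset\mathbb R^{d+1}$ put $$C_{\alpha,q}(A)=\inf\Big\{\int f^q\,dx\,dt \,:\, 0\le f\in L^q(\mathbb R^{d+1}),\ \mathscr G_\alpha* f\ge 1\text{ on }A\Big\}.$$ **Dyadic lattices.** A time-backward rectangle of side $\ell_R>0$ is a set $R=Q\times[t-\ell_R^2,t)$,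 where $Q\subset\mathbb R^d$ is a half-open cube with sides parallel to the axes, of side length $\ell_R$. Put $\delta_3R=3Q\times(t-9\ell_R^2,t+9\ell_R^2)$, with $3Q$ the open concentric cube of side $3\ell_R$. For $j\ge0$ let $\mathfrak D_j(R)$ be the family of the $2^{dj}4^{j}$ time-backward rectangles of side $2^{-j}\ell_R$ obtained by cutting $Q$ into $2^j$ equal parts in each direction and the time interval into $4^j$ equal parts, and let $\mathfrak D(R)=\bigcup_{j\ge 0}\mathfrak D_j(R)$. A parabolic dyadic lattice on a set $U\subset\mathbb R^{d+1}$ is a family $\mathscr D$ of time-backward rectangles such that 1. $\mathfrak D(R)\subset\mathscr D$ for every $R\in\mathscr D$; 2. any $R',R''\in\mathscr D$ both belong to $\mathfrak D(R)$ for some $R\in\mathscr D$; 3. every compact $K\subset U$ is contained in some $R\in\mathscr D$. **Dyadic energies and capacity.** Given $\mathscr D$, choose for each $R\in\mathscr D$ a function $\eta_R\in C_c^\infty(\mathbb R^{d+1})$ with $\mathbf 1_R\le\eta_R\le\mathbf 1_{\delta_3R}$, and write $\mu(\eta_R)=\int\eta_R\,d\mu$. Define $$\mathrm E^{\mathscr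 D}_{\alpha,q}\mu=\int_{\mathbb R^{d+1}}\Big(\sum_{R\in\mathscr D,\ \ell_R<1}\ell_R^{\alpha-n}\mu(R)\mathbf 1_R\Big)^{q'}dx\,dt,\qquad \mathcal E\mu=\int_{\mathbb R^{d+1}}\ \sum_{R\in\mathscr D,\ \ell_R<1}\big(\ell_R^{\alpha q-n}\mu(\eta_R)\big)^{q'-1}\eta_R\,d\mu,$$ and, for compact $K$, $\ \mathscr C_{\alpha,q}(K)^{1/q}=\sup\{\mu(\mathbb R^{d+1}) : \mu\ge 0 \text{ a Radon measure},\ \mu(K^c)=0,\ \mathcal E\mu\le1\}$. **Lemma.** There is a constant $C<\infty$ depending only on $d,\alpha,q$ such that the following holds for every set $U$ with $\mathbb R^d\times(0,\infty)\subset U\subset\mathbb R^{d+1}$ (for instance $U=\mathbb R^{d+1}$), every parabolic dyadic lattice $\mathscr D$ on $U$ and every choice of the functions $\eta_R$. (a) For every Radon measure $\mu\ge0$ on $\mathbb R^{d+1}$ with $\mu(U^c)=0$, as quantities in $[0,\infty]$, $$C^{-1}\,\mathrm E^{\mathscr D}_{\alpha,q}\mu\le\mathcal E\mu\le C\,\mathrm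 E^{\mathscr D}_{\alpha,q}\mu\qquad\text{and}\qquad C^{-1}\,\mathrm E_{\alpha,q}\mu\le\mathcal E\mu\le C\,\mathrm E_{\alpha,q}\mu .$$ (b) For every compact $K\subset U$, $\quad C^{-1}\,C_{\alpha,q}(K)\le\mathscr C_{\alpha,q}(K)\le C\,C_{\alpha,q}(K)$. -/

import Mathlib

open MeasureTheory Set
open scoped ENNReal NNReal ContDiff

namespace ParabolicWolff

/-- Space-time `ℝ^d × ℝ`, with points `z = (x, t)`. Its homogeneous dimension for the parabolic
dilations `(x, t) ↦ (c x, c² t)` is `n = d + 2`. -/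
abbrev SpaceTime (d : ℕ) : Type := EuclideanSpace ℝ (Fin d) × ℝ

/-! ### Parabolic Bessel kernel, potentials, energy and capacity -/

/-- The parabolic Bessel kernel
`(4π)^(-d/2) Γ(α/2)⁻¹ t^(-(n-α)/2) exp(-t - |x|²/(4t))` for `t > 0`, and `0` for `t ≤ 0`. -/
noncomputable def besselKernel {d : ℕ} (α : ℝ) (z : SpaceTime d) : ℝ :=
  if 0 < z.2 then
    (4 * Real.pi) ^ (-(d : ℝ) / 2) * (Real.Gamma (α / 2))⁻¹ * z.2 ^ (-((d : ℝ) + 2 - α) / 2) *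
      Real.exp (-z.2 - ‖z.1‖ ^ 2 / (4 * z.2))
  else 0

/-- The backward parabolic Bessel potential of a measure, `w ↦ ∫ 𝒢_α(z - w) dμ(z)`. -/
noncomputable def backwardBesselPotential {d : ℕ} (α : ℝ) (μ : Measure (SpaceTime d))
    (w : SpaceTime d) : ℝ≥0∞ :=
  ∫⁻ z, ENNReal.ofReal (besselKernel α (z - w)) ∂μ

/-- The conjugate exponent `q' = q / (q - 1)`. -/
noncomputable def conjExp (q : ℝ) : ℝ := q / (q - 1)

/-- The continuous energy: the integral over space-time of the `q'`-th power of the backward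
parabolic Bessel potential. -/
noncomputable def besselEnergy {d : ℕ} (α q : ℝ) (μ : Measure (SpaceTime d)) : ℝ≥0∞ :=
  ∫⁻ w, backwardBesselPotential α μ w ^ conjExp q

/-- The parabolic Bessel capacity of a set: the infimum of `∫ f^q` over all nonnegative `f ∈ L^q`
with `𝒢_α ∗ f ≥ 1` at every point of `A` (and `∞` if there is no such `f`). -/
noncomputable def besselCapacity {d : ℕ} (α q : ℝ) (A : Set (SpaceTime d)) : ℝ≥0∞ :=
  ⨅ (f : SpaceTime d → ℝ) (_ : MemLp f (ENNReal.ofReal q) volume) (_ : ∀ w, 0 ≤ f w)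
    (_ : ∀ z ∈ A, 1 ≤ ∫⁻ w, ENNReal.ofReal (besselKernel α (z - w) * f w)),
    ∫⁻ w, ENNReal.ofReal (f w) ^ q

/-! ### Time-backward parabolic rectangles and parabolic dyadic lattices -/

/-- The data of a time-backward parabolic rectangle `Q × [t - ℓ², t)`, where `Q` is the cube with
centre `center` and side length `ℓ = side`, and `t = time`. -/
structure BackwardRect (d : ℕ) where
  center : EuclideanSpace ℝ (Fin d)
  time : ℝ
  side : ℝ
  side_pos : 0 < side

namespace BackwardRect

variable {d : ℕ}

/-- The points of the rectangle; half-open, so that the dyadic subrectangles of a rectangle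
partition it. -/
def toSet (R : BackwardRect d) : Set (SpaceTime d) :=
  {z | (∀ i, z.1 i ∈ Ico (R.center i - R.side / 2) (R.center i + R.side / 2)) ∧
    z.2 ∈ Ico (R.time - R.side ^ 2) R.time}

/-- The parabolic dilate `δ_c R = cQ × (t - c²ℓ², t + c²ℓ²)`, with `cQ` the open cube concentric
with `Q` of side `cℓ`. -/
def dilate (c : ℝ) (R : BackwardRect d) : Set (SpaceTime d) :=
  {z | (∀ i, z.1 i ∈ Ioo (R.center i - c * R.side / 2) (R.center i + c * R.side / 2)) ∧
    z.2 ∈ Ioo (R.time - c ^ 2 * R.side ^ 2) (R.time + c ^ 2 * R.side ^ 2)}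

/-- `R.IsDyadicSub j Q`: `R` belongs to the `j`-th dyadic generation of `Q`, which arises by
cutting the cube into `2^j` equal parts in each spatial direction and the time interval into `4^j`
equal parts. The members are again time-backward rectangles, with side `2^(-j) ℓ(Q)`. -/
def IsDyadicSub (R : BackwardRect d) (j : ℕ) (Q : BackwardRect d) : Prop :=
  R.side = Q.side / 2 ^ j ∧
  (∃ k : Fin d → ℕ, ∀ i, k i < 2 ^ j ∧
    R.center i = Q.center i - Q.side / 2 + ((k i : ℝ) + 1 / 2) * R.side) ∧
  ∃ m : ℕ, m < 4 ^ j ∧ R.time = Q.time - (m : ℝ) * R.side ^ 2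

end BackwardRect

/-- A parabolic dyadic lattice on `U`, in the sense of Lerner and Nazarov. -/
structure IsDyadicLattice {d : ℕ} (U : Set (SpaceTime d)) (𝒟 : Set (BackwardRect d)) : Prop where
  sub_mem : ∀ Q ∈ 𝒟, ∀ (j : ℕ) (R : BackwardRect d), R.IsDyadicSub j Q → R ∈ 𝒟
  common_ancestor : ∀ Q₁ ∈ 𝒟, ∀ Q₂ ∈ 𝒟, ∃ Q ∈ 𝒟,
    (∃ j, Q₁.IsDyadicSub j Q) ∧ ∃ j, Q₂.IsDyadicSub j Q
  exists_superset : ∀ K : Set (SpaceTime d), IsCompact K → K ⊆ U → ∃ Q ∈ 𝒟, K ⊆ Q.toSet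

/-! ### Dyadic energies and the dyadic capacity -/

/-- The truncated dyadic potential: the sum over `R ∈ 𝒟` with `ℓ_R < 1` of
`ℓ_R^(α-n) μ(R) 1_R`. -/
noncomputable def dyadicPotential {d : ℕ} (α : ℝ) (𝒟 : Set (BackwardRect d))
    (μ : Measure (SpaceTime d)) (w : SpaceTime d) : ℝ≥0∞ :=
  ∑' R : {R : BackwardRect d // R ∈ 𝒟 ∧ R.side < 1},
    ENNReal.ofReal (R.1.side ^ (α - ((d : ℝ) + 2))) * μ R.1.toSet *
      R.1.toSet.indicator (fun _ => (1 : ℝ≥0∞)) w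

/-- The dyadic energy: the integral over space-time of the `q'`-th power of the dyadic
potential. -/
noncomputable def dyadicEnergy {d : ℕ} (α q : ℝ) (𝒟 : Set (BackwardRect d))
    (μ : Measure (SpaceTime d)) : ℝ≥0∞ :=
  ∫⁻ w, dyadicPotential α 𝒟 μ w ^ conjExp q

/-- `φ ∈ C_c^∞` and `1_R ≤ φ ≤ 1_{δ_3 R}`. -/
structure IsCutoff {d : ℕ} (R : BackwardRect d) (φ : SpaceTime d → ℝ) : Prop where
  contDiff : ContDiff ℝ ∞ φ
  hasCompactSupport : HasCompactSupport φ
  le_apply : ∀ z, R.toSet.indicator (fun _ => (1 : ℝ)) z ≤ φ z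
  apply_le : ∀ z, φ z ≤ (R.dilate 3).indicator (fun _ => (1 : ℝ)) z

/-- The regularized dyadic Wolff potential: the sum over `R ∈ 𝒟` with `ℓ_R < 1` of
`(ℓ_R^(αq-n) μ(η_R))^(q'-1) η_R`, where `μ(η_R) = ∫ η_R dμ`. -/
noncomputable def regWolffPotential {d : ℕ} (α q : ℝ) (𝒟 : Set (BackwardRect d))
    (η : BackwardRect d → SpaceTime d → ℝ) (μ : Measure (SpaceTime d)) (w : SpaceTime d) : ℝ≥0∞ :=
  ∑' R : {R : BackwardRect d // R ∈ 𝒟 ∧ R.side < 1},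
    (ENNReal.ofReal (R.1.side ^ (α * q - ((d : ℝ) + 2))) *
        ∫⁻ z, ENNReal.ofReal (η R.1 z) ∂μ) ^ (conjExp q - 1) *
      ENNReal.ofReal (η R.1 w)

/-- The regularized dyadic energy: the integral of the regularized dyadic Wolff potential of `μ`
against `μ`. -/
noncomputable def regEnergy {d : ℕ} (α q : ℝ) (𝒟 : Set (BackwardRect d))
    (η : BackwardRect d → SpaceTime d → ℝ) (μ : Measure (SpaceTime d)) : ℝ≥0∞ :=
  ∫⁻ w, regWolffPotential α q 𝒟 η μ w ∂μ

/-- The parabolic dyadic capacity: its `q`-th root is the supremum of the total masses of the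
nonnegative Radon measures `μ` with `μ(Kᶜ) = 0` and regularized dyadic energy at most `1`. -/
noncomputable def dyadicCapacity {d : ℕ} (α q : ℝ) (𝒟 : Set (BackwardRect d))
    (η : BackwardRect d → SpaceTime d → ℝ) (K : Set (SpaceTime d)) : ℝ≥0∞ :=
  (⨆ (μ : Measure (SpaceTime d)) (_ : IsLocallyFiniteMeasure μ) (_ : μ Kᶜ = 0)
    (_ : regEnergy α q 𝒟 η μ ≤ 1), μ univ) ^ q

end ParabolicWolff

open ParabolicWolff

namespace ParabolicWolff

/-! ### Inequalities for sums of nonnegative functions -/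

/-! Write `p = q'` and `n = d + 2`. Every energy is compared with one quantity, the Wolff energy `∑
ℓ_R^((α-n)p+n) μ(R)^p` over a full parabolic grid whose coarsest side lies in `[1/2, 1)`. The
lattice members of side below one belong to such a grid, and the grid rectangles absent from the
lattice miss `U`, hence carry no mass (`IsDyadicLattice.exists_fits`). The bounds on the coarsest
side keep the constants independent of the lattice.

Since `(αq-n)(q'-1) = (α-n)q'+n`, the regularized energy is exactly the Wolff sum with `μ(η_R)` in
place of `μ(R)`, and `μ(R) ≤ μ(η_R) ≤` the mass of boundedly many neighbours. The dyadic energy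
dominates the Wolff energy because `∑ a^p ≤ (∑ a)^p`. The converse is Wolff's inequality: expand `(∑
u_j)^p` by summation by parts and use that the interaction of generations `i` and `i + k` decays
like `2^(-αk)` (`Grid.lintegral_nbhdMass_mul_le`).

The Bessel kernel is bounded above by neighbourhood dyadic kernels plus a tail summable over unit
cells (`exists_besselKernel_le_tsum`). From below it dominates dyadic kernels translated in time by
`2ℓ²`, as it vanishes for nonpositive times (`exists_tsum_le_besselKernel`). Invariance of Lebesgue
measure removes the translations one generation at a time.

For capacities, Tonelli and Hölder bound the mass of `μ` by the norm of a test function times the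
Bessel energy, so the energy comparison gives one inequality. For the other, minimise the Wolff
energy truncated at generation `N` over probability measures on `K` carried by finitely many points.
The Euler–Lagrange inequality makes the truncated Wolff potential at least the energy `E_N` on all
of `K`, and an explicit test function built from the minimiser gives a capacity at most a constant
times `E_N^(1-q)`. Thus `E_N` is bounded in `N`. A weak limit of the minimisers has controlled
regularized energy because each `η_R` is continuous, and a multiple of it competes in the dyadic
capacity. -/

theorem add_rpow_le_rpow_add_mul {p : ℝ} (hp : 1 < p) (x y : ℝ≥0∞) :
    (x + y) ^ p ≤ x ^ p + ENNReal.ofReal p * (y * (x + y) ^ (p - 1)) := by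
  have hp0 : 0 < p := by linarith
  have hpe : ENNReal.ofReal p ≠ 0 := by simpa using hp0
  rcases eq_or_ne x ∞ with rfl | hx
  · simp [hp0]
  rcases eq_or_ne y ∞ with rfl | hy
  · simp [ENNReal.top_rpow_of_pos (sub_pos.2 hp), ENNReal.mul_top hpe]
  lift x to ℝ≥0 using hx
  lift y to ℝ≥0 using hy
  rcases eq_or_ne (x + y) 0 with h0 | h0
  · have : (x : ℝ≥0∞) + y = 0 := by exact_mod_cast h0
    rw [this, ENNReal.zero_rpow_of_pos hp0]
    exact zero_le
  have hX : 0 < (x : ℝ) + y := by exact_mod_cast pos_iff_ne_zero.2 h0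
  have hreal : ((x : ℝ) + y) ^ p ≤ (x : ℝ) ^ p + p * (y * ((x : ℝ) + y) ^ (p - 1)) := by
    -- Bernoulli for `(x / (x + y))^p`; after multiplication by `(x + y)^p` this is the tangent-line
    -- bound for `t ↦ t^p` at `x + y`.
    have hb := one_add_mul_self_le_rpow_one_add (s := -(y / ((x : ℝ) + y)))
      (by rw [neg_le_neg_iff, div_le_one hX]; linarith [x.coe_nonneg]) hp.le
    have h1 : (1 : ℝ) + -(y / ((x : ℝ) + y)) = x / (x + y) := by field_simp; ring
    rw [h1, Real.div_rpow x.coe_nonneg hX.le] at hb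
    have hXp : 0 < ((x : ℝ) + y) ^ p := Real.rpow_pos_of_pos hX p
    rw [le_div_iff₀ hXp] at hb
    have h2 : ((x : ℝ) + y) ^ (p - 1) = ((x : ℝ) + y) ^ p / (x + y) := by
      rw [Real.rpow_sub hX, Real.rpow_one]
    rw [h2]
    calc _ = (1 + p * -(y / ((x : ℝ) + y))) * ((x : ℝ) + y) ^ p
          + p * (y * (((x : ℝ) + y) ^ p / (x + y))) := by ring
      _ ≤ _ := by gcongr
  have hnn : (x + y) ^ p ≤ x ^ p + p.toNNReal * (y * (x + y) ^ (p - 1)) := by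
    rw [← NNReal.coe_le_coe]; push_cast; rw [Real.coe_toNNReal _ hp0.le]; exact hreal
  have h4 := ENNReal.coe_le_coe.2 hnn
  push_cast at h4
  rw [ENNReal.coe_rpow_of_nonneg _ hp0.le, ENNReal.coe_rpow_of_nonneg _ hp0.le,
    ENNReal.coe_rpow_of_nonneg _ (by linarith)] at h4
  push_cast at h4
  exact h4

/-- Summation by parts: the increments of the `p`-th powers of the partial sums are bounded one at a
time. The term `u j` is then paired only with generations no finer than its own. -/
theorem sum_range_rpow_le {p : ℝ} (hp : 1 < p) (u : ℕ → ℝ≥0∞) (N : ℕ) :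
    (∑ i ∈ Finset.range N, u i) ^ p ≤
      ENNReal.ofReal p * ∑ j ∈ Finset.range N, u j * (∑ i ∈ Finset.range (j + 1), u i) ^ (p - 1) := by
  induction N with
  | zero => simp [show 0 < p by linarith]
  | succ N ih =>
    rw [Finset.sum_range_succ (fun j => u j * _), mul_add]
    refine le_trans ?_ (add_le_add_left ih _)
    rw [Finset.sum_range_succ]
    exact add_rpow_le_rpow_add_mul hp _ _

theorem tsum_rpow_le {p : ℝ} (hp : 1 < p) (u : ℕ → ℝ≥0∞) :
    (∑' i, u i) ^ p ≤
      ENNReal.ofReal p * ∑' j, u j * (∑ i ∈ Finset.range (j + 1), u i) ^ (p - 1) := by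
  have h1 : Filter.Tendsto (fun N => (∑ i ∈ Finset.range N, u i) ^ p) Filter.atTop
      (nhds ((∑' i, u i) ^ p)) :=
    (ENNReal.continuous_rpow_const.tendsto _).comp (ENNReal.tendsto_nat_tsum u)
  refine le_of_tendsto' h1 fun N => (sum_range_rpow_le hp u N).trans ?_
  gcongr
  exact ENNReal.sum_le_tsum _

/-- Each `v i` is at most the `ℓ^s` quasi-norm of `v`. This crude bound needs only `0 < s`, so it
treats `p - 1` below and above one alike, where Hölder would require two cases. -/
theorem sum_mul_rpow_le {ι : Type*} (t : Finset ι) {s : ℝ} (hs : 0 < s) (a v : ι → ℝ≥0∞) :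
    (∑ i ∈ t, a i * v i) ^ s ≤ (∑ i ∈ t, a i) ^ s * ∑ i ∈ t, v i ^ s := by
  set M := ∑ i ∈ t, v i ^ s
  have h : ∑ i ∈ t, a i * v i ≤ (∑ i ∈ t, a i) * M ^ s⁻¹ := by
    rw [Finset.sum_mul]
    refine Finset.sum_le_sum fun i hi => ?_
    gcongr
    rw [ENNReal.le_rpow_inv_iff hs]
    exact Finset.single_le_sum (f := fun i => v i ^ s) (fun _ _ => zero_le) hi
  calc _ ≤ ((∑ i ∈ t, a i) * M ^ s⁻¹) ^ s := by gcongr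
    _ = _ := by rw [ENNReal.mul_rpow_of_nonneg _ _ hs.le, ENNReal.rpow_inv_rpow hs.ne']

theorem tsum_sum_antidiagonal (f : ℕ × ℕ → ℝ≥0∞) :
    ∑' n, ∑ x ∈ Finset.HasAntidiagonal.antidiagonal n, f x = ∑' i, ∑' k, f (i, k) := by
  rw [← ENNReal.tsum_prod, ← (Finset.HasAntidiagonal.sigmaAntidiagonalEquivProd (A := ℕ)).tsum_eq f, ENNReal.tsum_sigma']
  refine tsum_congr fun n => ?_
  rw [tsum_fintype, Finset.univ_eq_attach, ← Finset.sum_attach]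
  rfl

/-- Off-diagonal decay of `∫ u_{i+k} u_i^{p-1}` makes the `p`-th power of `∑ u_i` integrate to at
most the sum of the diagonal bounds. -/
theorem exists_lintegral_tsum_rpow_le {p : ℝ} (hp : 1 < p) {r : ℝ} (hr0 : 0 < r) (hr1 : r < 1) :
    ∃ C : ℝ≥0, ∀ {X : Type} [MeasurableSpace X] (μ : Measure X) (u : ℕ → X → ℝ≥0∞)
      (B : ℕ → ℝ≥0∞), (∀ i, Measurable (u i)) →
      (∀ i k, ∫⁻ w, u (i + k) w * u i w ^ (p - 1) ∂μ ≤ ENNReal.ofReal r ^ k * B i) →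
      ∫⁻ w, (∑' i, u i w) ^ p ∂μ ≤ C * ∑' i, B i := by
  have hs : 0 < p - 1 := sub_pos.2 hp
  -- The decay `r^k = b^k * b^k` is spent twice: one factor pays for the weights introduced below,
  -- the other leaves a convergent geometric series.
  set b : ℝ := Real.sqrt r with hb
  have hb0 : 0 < b := Real.sqrt_pos.2 hr0
  have hb1 : b < 1 := by rw [hb, Real.sqrt_lt' one_pos]; simpa using hr1
  have hbb : b * b = r := Real.mul_self_sqrt hr0.le
  -- Chosen so that the weights `a^k` become `b^k` once raised to the power `p - 1`.
  set a : ℝ := b ^ (p - 1)⁻¹ with ha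
  have ha0 : 0 < a := Real.rpow_pos_of_pos hb0 _
  have ha1 : a < 1 := Real.rpow_lt_one hb0.le hb1 (inv_pos.2 hs)
  have has : a ^ (p - 1) = b := Real.rpow_inv_rpow hb0.le hs.ne'
  have hgeom : ∀ x : ℝ, x < 1 → ∑' k : ℕ, ENNReal.ofReal x ^ k ≠ ⊤ := by
    intro x hx
    rw [ENNReal.tsum_geometric]
    refine ENNReal.inv_ne_top.2 (tsub_pos_of_lt ?_).ne'
    simpa using hx
  set A : ℝ≥0∞ := ∑' k : ℕ, ENNReal.ofReal a ^ k
  set D : ℝ≥0∞ := ∑' k : ℕ, ENNReal.ofReal b ^ k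
  have hC : ENNReal.ofReal p * (A ^ (p - 1) * D) ≠ ⊤ :=
    ENNReal.mul_ne_top ENNReal.ofReal_ne_top
      (ENNReal.mul_ne_top (ENNReal.rpow_ne_top_of_nonneg hs.le (hgeom a ha1)) (hgeom b hb1))
  refine ⟨(ENNReal.ofReal p * (A ^ (p - 1) * D)).toNNReal, ?_⟩
  intro X _ μ u B hu hB
  rw [ENNReal.coe_toNNReal hC]
  have hae : ENNReal.ofReal a ≠ 0 := by simpa using ha0
  have hbe : ENNReal.ofReal b ≠ 0 := by simpa using hb0
  have haes : ENNReal.ofReal a ^ (p - 1) = ENNReal.ofReal b := by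
    rw [ENNReal.ofReal_rpow_of_pos ha0, has]
  have key : ∀ w j, (∑ i ∈ Finset.range (j + 1), u i w) ^ (p - 1) ≤
      A ^ (p - 1) * ∑ x ∈ Finset.HasAntidiagonal.antidiagonal j,
        (ENNReal.ofReal b ^ x.2)⁻¹ * u x.1 w ^ (p - 1) := by
    intro w j
    have h1 : ∑ i ∈ Finset.range (j + 1), u i w = ∑ x ∈ Finset.HasAntidiagonal.antidiagonal j,
        ENNReal.ofReal a ^ x.2 * ((ENNReal.ofReal a ^ x.2)⁻¹ * u x.1 w) := by
      rw [← Finset.Nat.sum_antidiagonal_eq_sum_range_succ (fun i _ => u i w)]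
      refine Finset.sum_congr rfl fun x _ => ?_
      rw [← mul_assoc, ENNReal.mul_inv_cancel (pow_ne_zero _ hae)
        (ENNReal.pow_ne_top ENNReal.ofReal_ne_top), one_mul]
    rw [h1]
    refine (sum_mul_rpow_le _ hs _ _).trans ?_
    gcongr with x hx
    · rw [Finset.Nat.antidiagonal_eq_map', Finset.sum_map]
      exact ENNReal.sum_le_tsum _
    · rw [ENNReal.mul_rpow_of_nonneg _ _ hs.le, ENNReal.inv_rpow, ← ENNReal.rpow_natCast,
        ← ENNReal.rpow_mul, mul_comm (x.2 : ℝ), ENNReal.rpow_mul, haes, ENNReal.rpow_natCast]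
  have hmeas : ∀ i k, Measurable fun w => u (i + k) w * u i w ^ (p - 1) := fun i k =>
    (hu _).mul ((hu i).pow_const _)
  calc ∫⁻ w, (∑' i, u i w) ^ p ∂μ
      ≤ ∫⁻ w, ENNReal.ofReal p * (A ^ (p - 1) * ∑' i, ∑' k, (ENNReal.ofReal b ^ k)⁻¹ *
          (u (i + k) w * u i w ^ (p - 1))) ∂μ := by
        refine lintegral_mono fun w => (tsum_rpow_le hp _).trans ?_
        gcongr
        rw [← tsum_sum_antidiagonal (fun x => (ENNReal.ofReal b ^ x.2)⁻¹ *
          (u (x.1 + x.2) w * u x.1 w ^ (p - 1))), ← ENNReal.tsum_mul_left]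
        refine ENNReal.tsum_le_tsum fun j => ?_
        refine (mul_le_mul_right (key w j) _).trans_eq ?_
        rw [mul_left_comm, Finset.mul_sum]
        congr 1
        refine Finset.sum_congr rfl fun x hx => ?_
        rw [Finset.HasAntidiagonal.mem_antidiagonal.1 hx]
        ring
    _ = ENNReal.ofReal p * (A ^ (p - 1) * ∑' i, ∑' k, (ENNReal.ofReal b ^ k)⁻¹ *
          ∫⁻ w, u (i + k) w * u i w ^ (p - 1) ∂μ) := by
        have hm1 : ∀ i k, Measurable fun w => (ENNReal.ofReal b ^ k)⁻¹ *
            (u (i + k) w * u i w ^ (p - 1)) := fun i k => (hmeas i k).const_mul _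
        have hm2 : ∀ i, Measurable fun w => ∑' k, (ENNReal.ofReal b ^ k)⁻¹ *
            (u (i + k) w * u i w ^ (p - 1)) := fun i => Measurable.tsum (hm1 i)
        rw [lintegral_const_mul _ ((Measurable.tsum hm2).const_mul _),
          lintegral_const_mul _ (Measurable.tsum hm2),
          lintegral_tsum fun i => (hm2 i).aemeasurable]
        congr 3
        ext i
        rw [lintegral_tsum fun k => (hm1 i k).aemeasurable]
        simp_rw [lintegral_const_mul _ (hmeas i _)]
    _ ≤ ENNReal.ofReal p * (A ^ (p - 1) * ∑' i, ∑' k, ENNReal.ofReal b ^ k * B i) := by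
        gcongr 1
        gcongr 1
        refine ENNReal.tsum_le_tsum fun i => ENNReal.tsum_le_tsum fun k => ?_
        refine (mul_le_mul_right (hB i k) _).trans_eq ?_
        rw [← hbb, ENNReal.ofReal_mul hb0.le, mul_pow, ← mul_assoc, ← mul_assoc,
          ENNReal.inv_mul_cancel (pow_ne_zero _ hbe)
          (ENNReal.pow_ne_top ENNReal.ofReal_ne_top), one_mul]
    _ = _ := by
        simp_rw [ENNReal.tsum_mul_right, ENNReal.tsum_mul_left]
        ring

/-- Jensen's inequality for a weighted sum. -/
theorem tsum_mul_rpow_le {ι : Type*} {p : ℝ} (hp : 1 < p) (b f : ι → ℝ≥0∞) :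
    (∑' v, b v * f v) ^ p ≤ (∑' v, b v) ^ (p - 1) * ∑' v, b v * f v ^ p := by
  -- Hölder for the counting measure, with `b` split as `b^(1/p)` times `b^(1/p')`.
  let _ : MeasurableSpace ι := ⊤
  have hp0 : 0 < p := by linarith
  have hpq : p.HolderConjugate (p / (p - 1)) := Real.HolderConjugate.conjExponent hp
  have h := ENNReal.lintegral_mul_le_Lp_mul_Lq Measure.count hpq
    (f := fun v => b v ^ p⁻¹ * f v) (g := fun v => b v ^ (p / (p - 1))⁻¹)
    measurable_from_top.aemeasurable measurable_from_top.aemeasurable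
  simp only [lintegral_count, Pi.mul_apply] at h
  have e1 : ∀ v, b v ^ p⁻¹ * f v * b v ^ (p / (p - 1))⁻¹ = b v * f v := by
    intro v
    rw [mul_right_comm, ← ENNReal.rpow_add_of_nonneg _ _ (inv_nonneg.2 hp0.le) hpq.symm.inv_nonneg,
      hpq.inv_add_inv_eq_one, ENNReal.rpow_one]
  have e2 : ∀ v, (b v ^ p⁻¹ * f v) ^ p = b v * f v ^ p := by
    intro v
    rw [ENNReal.mul_rpow_of_nonneg _ _ hp0.le, ENNReal.rpow_inv_rpow hp0.ne']
  have e3 : ∀ v, (b v ^ (p / (p - 1))⁻¹) ^ (p / (p - 1)) = b v := fun v =>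
    ENNReal.rpow_inv_rpow hpq.symm.ne_zero _
  simp only [e1, e2, e3] at h
  calc _ ≤ ((∑' v, b v * f v ^ p) ^ (1 / p) * (∑' v, b v) ^ (1 / (p / (p - 1)))) ^ p := by gcongr
    _ = _ := by
      rw [ENNReal.mul_rpow_of_nonneg _ _ hp0.le, ← ENNReal.rpow_mul, ← ENNReal.rpow_mul,
        one_div_mul_cancel hp0.ne', ENNReal.rpow_one, mul_comm]
      congr 2
      field_simp

/-- Young's inequality for convolutions on a discrete group. -/
theorem tsum_conv_rpow_le {Λ : Type*} [AddGroup Λ] {p : ℝ} (hp : 1 < p) (b a : Λ → ℝ≥0∞) :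
    ∑' κ, (∑' v, b v * a (κ + v)) ^ p ≤ (∑' v, b v) ^ p * ∑' κ, a κ ^ p := by
  calc _ ≤ ∑' κ, (∑' v, b v) ^ (p - 1) * ∑' v, b v * a (κ + v) ^ p :=
        ENNReal.tsum_le_tsum fun κ => tsum_mul_rpow_le hp _ _
    _ = (∑' v, b v) ^ (p - 1) * ((∑' v, b v) * ∑' κ, a κ ^ p) := by
        rw [ENNReal.tsum_mul_left, ENNReal.tsum_comm, ← ENNReal.tsum_mul_right]
        congr 2
        ext v
        rw [ENNReal.tsum_mul_left, ← (Equiv.addRight v).tsum_eq (fun κ => a κ ^ p)]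
        rfl
    _ = _ := by
        rw [← mul_assoc]
        congr 1
        nth_rw 2 [← ENNReal.rpow_one (∑' v, b v)]
        rw [← ENNReal.rpow_add_of_nonneg _ _ (by linarith) zero_le_one]
        simp

theorem tsum_pi_fin_prod (β : ℤ → ℝ≥0∞) (d : ℕ) :
    ∑' v : Fin d → ℤ, ∏ i, β (v i) = (∑' k, β k) ^ d := by
  induction d with
  | zero => simp
  | succ d ih =>
    rw [← (Fin.consEquiv fun _ : Fin (d + 1) => ℤ).tsum_eq, ENNReal.tsum_prod']
    simp only [Fin.consEquiv_apply, Fin.prod_univ_succ, Fin.cons_zero, Fin.cons_succ]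
    simp_rw [ENNReal.tsum_mul_left, ih, ENNReal.tsum_mul_right, pow_succ']

/-! ### Full parabolic dyadic grids -/

/-- The data of a parabolic dyadic grid of unit scale: the lower corner and the side length of one
rectangle of the coarsest generation. -/
structure Grid (d : ℕ) where
  base : EuclideanSpace ℝ (Fin d)
  time : ℝ
  side : ℝ
  half_le : 1 / 2 ≤ side
  lt_one : side < 1

/-- Labels of the rectangles of one generation of a grid. -/
abbrev Index (d : ℕ) : Type := (Fin d → ℤ) × ℤ

/-- The labels all of whose coordinates are at most `m` in absolute value. -/
noncomputable def box (d : ℕ) (m : ℤ) : Finset (Index d) :=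
  Fintype.piFinset (fun _ => Finset.Icc (-m) m) ×ˢ Finset.Icc (-m) m

theorem mem_box {d : ℕ} {m : ℤ} {v : Index d} : v ∈ box d m ↔ (∀ i, |v.1 i| ≤ m) ∧ |v.2| ≤ m := by
  simp only [box, Finset.mem_product, Fintype.mem_piFinset, Finset.mem_Icc, abs_le]

theorem neg_mem_box {d : ℕ} {m : ℤ} {v : Index d} : -v ∈ box d m ↔ v ∈ box d m := by
  simp [mem_box]

theorem add_mem_box {d : ℕ} {m m' : ℤ} {v v' : Index d} (h : v ∈ box d m) (h' : v' ∈ box d m') :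
    v + v' ∈ box d (m + m') := by
  rw [mem_box] at *
  exact ⟨fun i => (abs_add_le _ _).trans (add_le_add (h.1 i) (h'.1 i)),
    (abs_add_le _ _).trans (add_le_add h.2 h'.2)⟩

/-- Raising a quotient by `m` raises the dividend by `m * c ≥ m`. Labels of ancestors are integer
quotients, so rectangles within `m` labels of each other have ancestors within `m` labels. -/
theorem abs_ediv_sub_ediv_le {a b m c : ℤ} (hc : 0 < c) (h : |a - b| ≤ m) :
    |a / c - b / c| ≤ m := by
  have key : ∀ x y : ℤ, x ≤ y + m → x / c ≤ y / c + m := by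
    intro x y hxy
    have hm : 0 ≤ m := (abs_nonneg _).trans h
    calc x / c ≤ (y + m * c) / c := Int.ediv_le_ediv hc (by nlinarith)
      _ = _ := Int.add_mul_ediv_right _ _ hc.ne'
  rw [abs_le] at h ⊢
  constructor
  · linarith [key b a (by linarith)]
  · linarith [key a b (by linarith)]

namespace Grid

variable {d : ℕ} (G : Grid d)

/-- The side length of the rectangles of generation `j`. -/
noncomputable def scale (j : ℕ) : ℝ := G.side / 2 ^ j

theorem side_pos : 0 < G.side := by linarith [G.half_le]

theorem scale_pos (j : ℕ) : 0 < G.scale j := div_pos G.side_pos (by positivity)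

theorem scale_zero : G.scale 0 = G.side := by simp [scale]

theorem scale_add (i k : ℕ) : G.scale (i + k) = G.scale i / 2 ^ k := by
  rw [scale, scale, pow_add, div_div]

theorem scale_lt_one (j : ℕ) : G.scale j < 1 := by
  rw [scale, div_lt_one (by positivity)]
  exact G.lt_one.trans_le (one_le_pow₀ one_le_two)

theorem scale_injective : Function.Injective G.scale := by
  intro i j h
  rw [scale, scale, div_eq_div_iff (by positivity) (by positivity),
    mul_right_inj' G.side_pos.ne'] at h
  exact (pow_right_injective₀ two_pos (by norm_num) h).symm

/-- The label of the rectangle of generation `j` containing a point. -/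
noncomputable def cell (j : ℕ) (z : SpaceTime d) : Index d :=
  (fun i => ⌊(z.1 i - G.base i) / G.scale j⌋, ⌊(z.2 - G.time) / G.scale j ^ 2⌋)

/-- The rectangle of generation `j` with a given label. -/
noncomputable def rect (j : ℕ) (κ : Index d) : BackwardRect d where
  center := WithLp.toLp 2 fun i => G.base i + ((κ.1 i : ℝ) + 1 / 2) * G.scale j
  -- The time of a `BackwardRect` is the upper end of its interval, whereas that of a `Grid` is the
  -- lower corner; hence the `+ 1`.
  time := G.time + ((κ.2 : ℝ) + 1) * G.scale j ^ 2
  side := G.scale j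
  side_pos := G.scale_pos j

@[simp] theorem rect_side (j : ℕ) (κ : Index d) : (G.rect j κ).side = G.scale j := rfl

theorem mem_rect {j : ℕ} {κ : Index d} {z : SpaceTime d} :
    z ∈ (G.rect j κ).toSet ↔ G.cell j z = κ := by
  have hl := G.scale_pos j
  have hl2 : 0 < G.scale j ^ 2 := by positivity
  rw [BackwardRect.toSet, mem_ofPred_eq, Prod.ext_iff, funext_iff]
  simp only [cell, rect, Int.floor_eq_iff, le_div_iff₀ hl, div_lt_iff₀ hl, le_div_iff₀ hl2,
    div_lt_iff₀ hl2, mem_Ico]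
  refine and_congr (forall_congr' fun i => ?_) ?_
  · constructor <;> rintro ⟨h1, h2⟩ <;> constructor <;> linarith
  · constructor <;> rintro ⟨h1, h2⟩ <;> constructor <;> linarith

theorem toSet_rect (j : ℕ) (κ : Index d) : (G.rect j κ).toSet = G.cell j ⁻¹' {κ} := by
  ext z; exact G.mem_rect

theorem rect_injective : Function.Injective fun x : ℕ × Index d => G.rect x.1 x.2 := by
  rintro ⟨j, κ⟩ ⟨j', κ'⟩ h
  have hj : j = j' := G.scale_injective (congrArg BackwardRect.side h)
  subst hj
  have hl := G.scale_pos j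
  have h1 := congrArg BackwardRect.center h
  have h2 := congrArg BackwardRect.time h
  simp only [rect, WithLp.toLp.injEq, funext_iff] at h1 h2
  congr 1
  refine Prod.ext (funext fun i => ?_) ?_
  · have := mul_right_cancel₀ hl.ne' (add_left_cancel (h1 i))
    exact_mod_cast add_right_cancel this
  · have := mul_right_cancel₀ (pow_pos hl 2).ne' (add_left_cancel h2)
    exact_mod_cast add_right_cancel this

theorem measurable_cell (j : ℕ) : Measurable (G.cell j) := by
  unfold cell
  fun_prop

theorem measurableSet_cell (j : ℕ) (S : Set (Index d)) : MeasurableSet (G.cell j ⁻¹' S) :=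
  G.measurable_cell j S.to_countable.measurableSet

theorem volume_cell (j : ℕ) (κ : Index d) :
    volume (G.cell j ⁻¹' {κ}) = ENNReal.ofReal (G.scale j) ^ ((d : ℝ) + 2) := by
  have hl := G.scale_pos j
  rw [← toSet_rect]
  have h : (G.rect j κ).toSet = (WithLp.ofLp ⁻¹' Set.pi univ fun i =>
      Ico ((G.rect j κ).center i - G.scale j / 2) ((G.rect j κ).center i + G.scale j / 2)) ×ˢ
      Ico ((G.rect j κ).time - G.scale j ^ 2) (G.rect j κ).time := by
    ext z; simp [BackwardRect.toSet]
  rw [h, Measure.volume_eq_prod, Measure.prod_prod,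
    (PiLp.volume_preserving_ofLp (Fin d)).measure_preimage
      (MeasurableSet.univ_pi fun i => measurableSet_Ico).nullMeasurableSet, Real.volume_pi_Ico,
    Real.volume_Ico]
  simp only [add_sub_sub_cancel, add_halves, sub_sub_cancel, Finset.prod_const, Finset.card_univ,
    Fintype.card_fin]
  rw [ENNReal.ofReal_pow hl.le, ← pow_add, ← ENNReal.rpow_natCast]
  push_cast; rfl

theorem lintegral_cell (j : ℕ) (μ : Measure (SpaceTime d)) (g : Index d → ℝ≥0∞) :
    ∫⁻ z, g (G.cell j z) ∂μ = ∑' κ, g κ * μ (G.cell j ⁻¹' {κ}) := by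
  rw [← lintegral_map (measurable_of_countable g) (G.measurable_cell j), lintegral_countable']
  simp_rw [Measure.map_apply (G.measurable_cell j) (measurableSet_singleton _)]

/-- Dyadic nesting expressed through labels, from `⌊x / m⌋ = ⌊x⌋ / m`. Parabolic scaling divides the
time label by `4 ^ k`. -/
theorem cell_add (i k : ℕ) (z : SpaceTime d) :
    G.cell i z = (fun l => (G.cell (i + k) z).1 l / 2 ^ k, (G.cell (i + k) z).2 / 4 ^ k) := by
  have hl := G.scale_pos i
  have key : ∀ (x : ℝ) (m : ℕ), ⌊x / m⌋ = ⌊x⌋ / (m : ℤ) := fun x m => Int.floor_div_natCast x m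
  refine Prod.ext (funext fun l => ?_) ?_
  · simp only [cell]
    rw [scale_add]
    have := key ((z.1 l - G.base l) / (G.scale i / 2 ^ k)) (2 ^ k)
    push_cast at this
    rw [← this]
    congr 1
    field_simp
  · simp only [cell]
    rw [scale_add]
    have := key ((z.2 - G.time) / (G.scale i / 2 ^ k) ^ 2) (4 ^ k)
    push_cast at this
    rw [← this]
    congr 1
    have h4 : (4 : ℝ) ^ k = (2 ^ k) ^ 2 := by rw [← pow_mul, mul_comm, pow_mul]; norm_num
    rw [h4]
    field_simp

theorem cell_sub_mem_box_of_add {i k : ℕ} {m : ℤ} {z w : SpaceTime d}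
    (h : G.cell (i + k) z - G.cell (i + k) w ∈ box d m) : G.cell i z - G.cell i w ∈ box d m := by
  rw [mem_box] at *
  rw [G.cell_add i k z, G.cell_add i k w]
  exact ⟨fun l => abs_ediv_sub_ediv_le (by positivity) (h.1 l),
    abs_ediv_sub_ediv_le (by positivity) h.2⟩

/-- The mass of the rectangles of generation `j` whose label differs from `κ` by at most `m`. -/
noncomputable def nbhdMass (μ : Measure (SpaceTime d)) (m : ℤ) (j : ℕ) (κ : Index d) : ℝ≥0∞ :=
  μ {z | G.cell j z - κ ∈ box d m}

theorem nbhdMass_eq (μ : Measure (SpaceTime d)) (m : ℤ) (j : ℕ) (κ : Index d) :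
    G.nbhdMass μ m j κ = ∑ v ∈ box d m, μ (G.cell j ⁻¹' {κ + v}) := by
  have : {z | G.cell j z - κ ∈ box d m} = ⋃ v ∈ box d m, G.cell j ⁻¹' {κ + v} := by
    ext z
    simp only [mem_ofPred_eq, mem_iUnion, mem_preimage, mem_singleton_iff, exists_prop]
    constructor
    · intro h; exact ⟨_, h, by abel⟩
    · rintro ⟨v, hv, h⟩; rw [h]; simpa using hv
  rw [nbhdMass, this, measure_biUnion_finset]
  · intro v _ v' _ hne
    refine Disjoint.preimage _ ?_
    simpa using hne
  · exact fun v _ => G.measurableSet_cell j _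

/-- Bounded overlap: neighbourhood masses are the cell masses convolved with the indicator of a box,
and Young's inequality applies. -/
theorem tsum_nbhdMass_rpow_le {p : ℝ} (hp : 1 < p) (μ : Measure (SpaceTime d)) (m : ℤ) (j : ℕ) :
    ∑' κ, G.nbhdMass μ m j κ ^ p ≤
      ((box d m).card : ℝ≥0∞) ^ p * ∑' κ, μ (G.cell j ⁻¹' {κ}) ^ p := by
  have h := tsum_conv_rpow_le hp ((box d m : Set (Index d)).indicator 1)
    (fun κ => μ (G.cell j ⁻¹' {κ}))
  have hb : ∑' v, (box d m : Set (Index d)).indicator (1 : Index d → ℝ≥0∞) v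
      = (box d m).card := by
    rw [← tsum_subtype]; simp
  have hf : ∀ κ, ∑' v, (box d m : Set (Index d)).indicator (1 : Index d → ℝ≥0∞) v *
      μ (G.cell j ⁻¹' {κ + v}) = G.nbhdMass μ m j κ := by
    intro κ
    rw [nbhdMass_eq, tsum_eq_sum (s := box d m) fun v hv => by simp [hv]]
    exact Finset.sum_congr rfl fun v hv => by simp [hv]
  simpa only [hb, hf] using h

/-- The dyadic Wolff energy of a measure over all rectangles of a grid. -/
noncomputable def wolffEnergy (α p : ℝ) (μ : Measure (SpaceTime d)) : ℝ≥0∞ :=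
  ∑' j, ENNReal.ofReal (G.scale j) ^ ((α - (d + 2)) * p + (d + 2)) *
    ∑' κ, μ (G.cell j ⁻¹' {κ}) ^ p

end Grid
/-! ### Dyadic lattices and grids -/

namespace BackwardRect

variable {d : ℕ} {R Q : BackwardRect d} {j : ℕ}

theorem ext_of {R Q : BackwardRect d} (hc : ∀ i, R.center i = Q.center i) (ht : R.time = Q.time)
    (hs : R.side = Q.side) : R = Q := by
  cases R; cases Q
  simp only [mk.injEq] at *
  exact ⟨by ext i; exact hc i, ht, hs⟩

theorem four_pow_mul_sq (h : R.side = Q.side / 2 ^ j) : 4 ^ j * R.side ^ 2 = Q.side ^ 2 := by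
  have h4 : (4 : ℝ) ^ j = (2 ^ j) ^ 2 := by rw [← pow_mul, mul_comm, pow_mul]; norm_num
  rw [h, h4]
  field_simp

theorem IsDyadicSub.toSet_subset (h : R.IsDyadicSub j Q) : R.toSet ⊆ Q.toSet := by
  obtain ⟨hs, ⟨k, hk⟩, m, hm, ht⟩ := h
  have hR := R.side_pos
  have hQ : 2 ^ j * R.side = Q.side := by rw [hs]; field_simp
  have hQ2 := four_pow_mul_sq hs
  rintro z ⟨h1, h2, h3⟩
  refine ⟨fun i => ?_, ?_, ?_⟩
  · obtain ⟨hkj, hc⟩ := hk i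
    obtain ⟨h4, h5⟩ := h1 i
    have hk0 : (0 : ℝ) ≤ k i := Nat.cast_nonneg _
    have hk1 : (k i : ℝ) + 1 ≤ 2 ^ j := by exact_mod_cast hkj
    have := mul_le_mul_of_nonneg_right hk1 hR.le
    have := mul_nonneg hk0 hR.le
    constructor <;> nlinarith
  · have hm1 : (m : ℝ) + 1 ≤ 4 ^ j := by exact_mod_cast hm
    have := mul_le_mul_of_nonneg_right hm1 (sq_nonneg R.side)
    nlinarith
  · have : 0 ≤ (m : ℝ) * R.side ^ 2 := by positivity
    linarith

theorem exists_isDyadicSub_mem (j : ℕ) {z : SpaceTime d} (hz : z ∈ Q.toSet) :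
    ∃ R : BackwardRect d, R.IsDyadicSub j Q ∧ z ∈ R.toSet := by
  obtain ⟨h1, h2, h3⟩ := hz
  have hQ := Q.side_pos
  set r : ℝ := Q.side / 2 ^ j with hr
  have hr0 : 0 < r := by positivity
  have hrQ : 2 ^ j * r = Q.side := by rw [hr]; field_simp
  have hr2 : 4 ^ j * r ^ 2 = Q.side ^ 2 := by
    have h4 : (4 : ℝ) ^ j = (2 ^ j) ^ 2 := by rw [← pow_mul, mul_comm, pow_mul]; norm_num
    rw [hr, h4]
    field_simp
  have hk : ∀ i, ∃ k : ℕ, k < 2 ^ j ∧ k * r ≤ z.1 i - (Q.center i - Q.side / 2) ∧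
      z.1 i - (Q.center i - Q.side / 2) < (k + 1) * r := by
    intro i
    obtain ⟨h4, h5⟩ := h1 i
    set y := z.1 i - (Q.center i - Q.side / 2) with hy
    have hy0 : 0 ≤ y / r := div_nonneg (by linarith) hr0.le
    have h6 := Nat.floor_le hy0
    refine ⟨⌊y / r⌋₊, ?_, (le_div_iff₀ hr0).1 h6, (div_lt_iff₀ hr0).1 (Nat.lt_floor_add_one _)⟩
    have : (⌊y / r⌋₊ : ℝ) < 2 ^ j := by
      refine h6.trans_lt ((div_lt_iff₀ hr0).2 ?_)
      rw [hrQ]; linarith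
    exact_mod_cast this
  choose k hk1 hk2 hk3 using hk
  obtain ⟨m, hm1, hm2, hm3⟩ : ∃ m : ℕ, m < 4 ^ j ∧ m * r ^ 2 < Q.time - z.2 ∧
      Q.time - z.2 ≤ (m + 1) * r ^ 2 := by
    set y := (Q.time - z.2) / r ^ 2 with hy
    have hy0 : 0 < y := div_pos (by linarith) (by positivity)
    -- Subrectangles are counted downwards from the excluded upper end, so the intervals for `y` are
    -- open on the left and `m` is the ceiling minus one.
    obtain ⟨m, hm⟩ : ∃ m, ⌈y⌉₊ = m + 1 := Nat.exists_eq_succ_of_ne_zero (Nat.ceil_pos.2 hy0).ne'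
    have h4 : (m : ℝ) < y := Nat.lt_ceil.1 (by omega)
    have h5 : y ≤ (m : ℝ) + 1 := by exact_mod_cast hm ▸ Nat.le_ceil y
    refine ⟨m, ?_, (lt_div_iff₀ (by positivity)).1 h4, (div_le_iff₀ (by positivity)).1 h5⟩
    have : (m : ℝ) < 4 ^ j := by
      refine h4.trans_le ((div_le_iff₀ (by positivity)).2 ?_)
      rw [hr2]; linarith
    exact_mod_cast this
  refine ⟨⟨WithLp.toLp 2 fun i => Q.center i - Q.side / 2 + ((k i : ℝ) + 1 / 2) * r,
    Q.time - m * r ^ 2, r, hr0⟩, ⟨rfl, ⟨k, fun i => ⟨hk1 i, rfl⟩⟩, m, hm1, rfl⟩, fun i => ?_, ?_, ?_⟩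
  · have := hk2 i
    have := hk3 i
    constructor <;> simp only [] <;> linarith
  · simp only []; linarith
  · simp only []; linarith

end BackwardRect

/-- The members of the lattice `𝒟` of side less than one belong to the grid `G`, and `𝒟` contains
all rectangles of `G` that meet `U`. -/
structure Grid.Fits {d : ℕ} (G : Grid d) (U : Set (SpaceTime d)) (𝒟 : Set (BackwardRect d)) :
    Prop where
  exists_eq_rect : ∀ R ∈ 𝒟, R.side < 1 → ∃ j κ, R = G.rect j κ
  rect_mem : ∀ z ∈ U, ∀ j, G.rect j (G.cell j z) ∈ 𝒟

/-- One lattice member of side in `[1/2, 1)` generates the grid. Any smaller member shares an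
ancestor with it, which aligns the two subdivisions; conversely, subdividing an ancestor common to
it and to a member containing a given point of `U` reaches every generation at that point. -/
theorem IsDyadicLattice.exists_fits {d : ℕ} {U : Set (SpaceTime d)} {𝒟 : Set (BackwardRect d)}
    (hU : {z : SpaceTime d | 0 < z.2} ⊆ U) (h𝒟 : IsDyadicLattice U 𝒟) :
    ∃ G : Grid d, G.Fits U 𝒟 := by
  -- A rectangle containing two points with time gap `2` has side at least one.
  obtain ⟨Q₁, hQ₁, hK⟩ := h𝒟.exists_superset {(0, 1), (0, 3)} (Set.toFinite _).isCompact (by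
    refine Subset.trans ?_ hU
    rintro z (rfl | rfl) <;> simp)
  have hside : 1 ≤ Q₁.side := by
    have h1 := (hK (mem_insert _ _)).2.1
    have h2 := (hK (mem_insert_of_mem _ rfl)).2.2
    simp only at h1 h2
    nlinarith [Q₁.side_pos]
  obtain ⟨n, hn1, hn2⟩ := exists_nat_pow_near hside one_lt_two
  obtain ⟨R₀, hR₀, hR₀Q⟩ : ∃ R₀ ∈ 𝒟, R₀.side = Q₁.side / 2 ^ (n + 1) := by
    obtain ⟨R₀, h, -⟩ := BackwardRect.exists_isDyadicSub_mem (n + 1) (hK (mem_insert _ _))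
    exact ⟨R₀, h𝒟.sub_mem _ hQ₁ _ _ h, h.1⟩
  have hle : 1 / 2 ≤ R₀.side := by
    rw [hR₀Q, div_le_div_iff₀ two_pos (by positivity), pow_succ]; linarith
  have hlt : R₀.side < 1 := by
    rw [hR₀Q, div_lt_one (by positivity)]; exact hn2
  let G : Grid d := ⟨WithLp.toLp 2 fun i => R₀.center i - R₀.side / 2, R₀.time - R₀.side ^ 2,
    R₀.side, hle, hlt⟩
  have h1 : ∀ R ∈ 𝒟, R.side < 1 → ∃ j κ, R = G.rect j κ := by
    intro R hR hR1
    obtain ⟨Q, hQ, ⟨a, ha, ⟨k, hk⟩, m, hm, ht⟩, b, hb, ⟨k', hk'⟩, m', hm', ht'⟩ :=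
      h𝒟.common_ancestor R₀ hR₀ R hR
    -- Otherwise `R` would have side at least `2 * R₀.side ≥ 1`.
    have hab : a ≤ b := by
      by_contra! hlt'
      obtain ⟨c, rfl⟩ := Nat.exists_eq_add_of_lt hlt'
      have : R.side = R₀.side * 2 ^ (c + 1) := by
        rw [ha, hb, add_assoc, pow_add]; field_simp
      have : (1 : ℝ) ≤ 2 ^ c := one_le_pow₀ one_le_two
      rw [pow_succ] at *
      nlinarith
    obtain ⟨j, rfl⟩ := Nat.exists_eq_add_of_le hab
    have hRs : R.side = R₀.side / 2 ^ j := by rw [ha, hb, pow_add, div_div]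
    have hR₀s : R₀.side = 2 ^ j * R.side := by rw [hRs]; field_simp
    have h4 := BackwardRect.four_pow_mul_sq hRs
    -- Positions of `R` relative to the lower corner of `R₀`. The time indices `m`, `m'` count
    -- downwards from the top of `Q`, so the time label is reversed and shifted by one.
    refine ⟨j, (fun i => k' i - k i * 2 ^ j, ((m : ℤ) + 1) * 4 ^ j - m' - 1),
      BackwardRect.ext_of (fun i => ?_) ?_ hRs⟩
    · have h5 := (hk i).2
      have h6 := (hk' i).2
      simp only [Grid.rect, Grid.scale, G, ← hRs]
      push_cast
      rw [h5, h6, hR₀s]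
      ring
    · simp only [Grid.rect, Grid.scale, G, ← hRs]
      push_cast
      rw [ht, ht', ← h4]
      ring
  refine ⟨G, h1, fun z hz j => ?_⟩
  obtain ⟨Q, hQ, hzQ⟩ := h𝒟.exists_superset {z} isCompact_singleton (by simpa using hz)
  obtain ⟨Q', hQ', ⟨a, ha⟩, b, hb⟩ := h𝒟.common_ancestor Q hQ R₀ hR₀
  -- `R₀` sits in generation `b` of `Q'`, so generation `b + j` has side `G.scale j`.
  obtain ⟨R, hR, hzR⟩ := BackwardRect.exists_isDyadicSub_mem (b + j)
    (ha.toSet_subset (hzQ rfl))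
  have hRs : R.side = G.scale j := by
    rw [hR.1, pow_add, ← div_div, ← hb.1]; rfl
  have hR𝒟 := h𝒟.sub_mem _ hQ' _ _ hR
  obtain ⟨i, κ, rfl⟩ := h1 R hR𝒟 (by rw [hRs]; exact G.scale_lt_one j)
  obtain rfl : i = j := G.scale_injective hRs
  rwa [G.mem_rect.1 hzR]

namespace Grid.Fits

variable {d : ℕ} {G : Grid d} {U : Set (SpaceTime d)} {𝒟 : Set (BackwardRect d)}

theorem rect_mem_or_measure_eq_zero (hG : G.Fits U 𝒟) {μ : Measure (SpaceTime d)} (hμ : μ Uᶜ = 0)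
    (j : ℕ) (κ : Index d) : G.rect j κ ∈ 𝒟 ∨ μ (G.cell j ⁻¹' {κ}) = 0 := by
  by_cases h : ∃ z ∈ U, G.cell j z = κ
  · obtain ⟨z, hz, rfl⟩ := h
    exact Or.inl (hG.rect_mem z hz j)
  · refine Or.inr (measure_mono_null (fun z hz hzU => h ⟨z, hzU, hz⟩) hμ)

theorem tsum_eq (hG : G.Fits U 𝒟) (g : BackwardRect d → ℝ≥0∞) :
    ∑' R : {R : BackwardRect d // R ∈ 𝒟 ∧ R.side < 1}, g R.1 =
      ∑' j, ∑' κ, 𝒟.indicator g (G.rect j κ) := by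
  have h1 : ∑' R : {R : BackwardRect d // R ∈ 𝒟 ∧ R.side < 1}, g R.1 =
      ∑' R, {R : BackwardRect d | R ∈ 𝒟 ∧ R.side < 1}.indicator g R :=
    tsum_subtype {R : BackwardRect d | R ∈ 𝒟 ∧ R.side < 1} g
  rw [h1, ← ENNReal.tsum_prod, ← G.rect_injective.tsum_eq]
  · refine tsum_congr fun x => ?_
    by_cases hx : G.rect x.1 x.2 ∈ 𝒟 <;> simp [hx, indicator, G.scale_lt_one]
  · intro R hR
    have hR₀ : R ∈ {R : BackwardRect d | R ∈ 𝒟 ∧ R.side < 1} := support_indicator_subset hR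
    have hR' : R ∈ 𝒟 ∧ R.side < 1 := hR₀
    obtain ⟨j, κ, rfl⟩ := hG.exists_eq_rect R hR'.1 hR'.2
    exact ⟨(j, κ), rfl⟩

theorem countable (hG : G.Fits U 𝒟) : Countable {R : BackwardRect d // R ∈ 𝒟 ∧ R.side < 1} := by
  choose j κ h using fun R : {R : BackwardRect d // R ∈ 𝒟 ∧ R.side < 1} =>
    hG.exists_eq_rect R.1 R.2.1 R.2.2
  refine Function.Injective.countable (f := fun R => (j R, κ R)) fun R R' hRR' => ?_
  simp only [Prod.mk.injEq] at hRR'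
  exact Subtype.ext (by rw [h R, h R', hRR'.1, hRR'.2])

end Grid.Fits
/-! ### Dyadic energies as Wolff energies -/

theorem one_lt_conjExp {q : ℝ} (hq : 1 < q) : 1 < conjExp q := by
  rw [conjExp, one_lt_div (by linarith)]; linarith

/-- This identity makes the weights of the regularized energy agree with those of the Wolff energy.
-/
theorem conjExp_exponent {q : ℝ} (hq : 1 < q) (α n : ℝ) :
    (α * q - n) * (conjExp q - 1) = (α - n) * conjExp q + n := by
  have : q - 1 ≠ 0 := by linarith
  rw [conjExp]; field_simp; ring

theorem tsum_rpow_le_rpow_tsum {ι : Type*} {p : ℝ} (hp : 1 < p) (a : ι → ℝ≥0∞) :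
    ∑' i, a i ^ p ≤ (∑' i, a i) ^ p := by
  have h : ∀ x : ℝ≥0∞, x ^ p = x * x ^ (p - 1) := fun x => by
    nth_rw 2 [← ENNReal.rpow_one x]
    rw [← ENNReal.rpow_add_of_nonneg _ _ zero_le_one (by linarith)]
    simp
  rw [h, ← ENNReal.tsum_mul_right]
  refine ENNReal.tsum_le_tsum fun i => ?_
  rw [h]
  gcongr
  exact ENNReal.le_tsum i

namespace Grid

variable {d : ℕ} (G : Grid d)

theorem ofReal_scale_ne_zero (j : ℕ) : ENNReal.ofReal (G.scale j) ≠ 0 := by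
  simpa using G.scale_pos j

theorem scale_rpow_mul_rpow (j : ℕ) {p : ℝ} (hp : 0 ≤ p) (a b : ℝ) (x : ℝ≥0∞) :
    (ENNReal.ofReal (G.scale j) ^ a * x) ^ p * ENNReal.ofReal (G.scale j) ^ b =
      ENNReal.ofReal (G.scale j) ^ (a * p + b) * x ^ p := by
  rw [ENNReal.mul_rpow_of_nonneg _ _ hp, ← ENNReal.rpow_mul,
    ENNReal.rpow_add _ _ (G.ofReal_scale_ne_zero j) ENNReal.ofReal_ne_top]
  ring

/-- The integral over space-time of the `p`-th power of the term of generation `j` of the dyadic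
potential. -/
theorem lintegral_scale_mul_measure_cell (j : ℕ) {p : ℝ} (hp : 0 ≤ p) (α : ℝ)
    (μ : Measure (SpaceTime d)) :
    ∫⁻ w, (ENNReal.ofReal (G.scale j) ^ (α - ((d : ℝ) + 2)) *
      μ (G.cell j ⁻¹' {G.cell j w})) ^ p =
      ENNReal.ofReal (G.scale j) ^ ((α - (d + 2)) * p + (d + 2)) *
        ∑' κ, μ (G.cell j ⁻¹' {κ}) ^ p := by
  rw [G.lintegral_cell j volume (fun κ => (ENNReal.ofReal (G.scale j) ^ (α - ((d : ℝ) + 2)) *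
    μ (G.cell j ⁻¹' {κ})) ^ p), ← ENNReal.tsum_mul_left]
  simp_rw [volume_cell, G.scale_rpow_mul_rpow j hp]

theorem measurable_measure_cell (j : ℕ) (μ : Measure (SpaceTime d)) :
    Measurable fun w => μ (G.cell j ⁻¹' {G.cell j w}) :=
  (measurable_of_countable fun κ => μ (G.cell j ⁻¹' {κ})).comp (G.measurable_cell j)

/-- The `9 = 3²` is dictated by time: the upper end of the rectangle is at label `κ + 1`, so the
dilate reaches labels from `κ - 8` to `κ + 9`. In space the adjacent labels would suffice. -/
theorem mem_box_of_mem_dilate {j : ℕ} {κ : Index d} {z : SpaceTime d}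
    (hz : z ∈ (G.rect j κ).dilate 3) : G.cell j z - κ ∈ box d 9 := by
  have hl := G.scale_pos j
  have hl2 : 0 < G.scale j ^ 2 := by positivity
  obtain ⟨h1, h2, h3⟩ := hz
  simp only [rect] at h1 h2 h3
  rw [mem_box]
  have key : ∀ (x : ℝ) (a : ℤ), (a : ℝ) - 9 ≤ x → x < a + 10 → |⌊x⌋ - a| ≤ 9 := by
    intro x a h4 h5
    have h6 : a - 9 ≤ ⌊x⌋ := Int.le_floor.2 (by push_cast; exact h4)
    have h7 : ⌊x⌋ < a + 10 := Int.floor_lt.2 (by push_cast; exact h5)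
    rw [abs_le]; omega
  refine ⟨fun i => ?_, ?_⟩
  · obtain ⟨h4, h5⟩ := h1 i
    refine key _ _ ?_ ?_
    · rw [le_div_iff₀ hl]; linarith
    · rw [div_lt_iff₀ hl]; linarith
  · refine key _ _ ?_ ?_
    · rw [le_div_iff₀ hl2]; linarith
    · rw [div_lt_iff₀ hl2]; linarith

end Grid

theorem IsCutoff.measure_le_lintegral {d : ℕ} {G : Grid d} {j : ℕ} {κ : Index d}
    {φ : SpaceTime d → ℝ} (hφ : IsCutoff (G.rect j κ) φ) (μ : Measure (SpaceTime d)) :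
    μ (G.cell j ⁻¹' {κ}) ≤ ∫⁻ z, ENNReal.ofReal (φ z) ∂μ := by
  rw [← lintegral_indicator_one (G.measurableSet_cell j _), ← G.toSet_rect]
  refine lintegral_mono fun z => ?_
  have := hφ.le_apply z
  by_cases hz : z ∈ (G.rect j κ).toSet
  · simpa [hz] using this
  · simp [hz]

theorem IsCutoff.lintegral_le_nbhdMass {d : ℕ} {G : Grid d} {j : ℕ} {κ : Index d}
    {φ : SpaceTime d → ℝ} (hφ : IsCutoff (G.rect j κ) φ) (μ : Measure (SpaceTime d)) :
    ∫⁻ z, ENNReal.ofReal (φ z) ∂μ ≤ G.nbhdMass μ 9 j κ := by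
  have hm : MeasurableSet {z | G.cell j z - κ ∈ box d 9} :=
    (G.measurable_cell j).sub_const κ (box d 9).measurableSet
  rw [Grid.nbhdMass, ← lintegral_indicator_one hm]
  refine lintegral_mono fun z => ?_
  have := hφ.apply_le z
  by_cases hz : z ∈ (G.rect j κ).dilate 3
  · have hz' : z ∈ {z | G.cell j z - κ ∈ box d 9} := G.mem_box_of_mem_dilate hz
    simp only [indicator_of_mem hz] at this
    rw [indicator_of_mem hz']
    simpa using this
  · simp only [indicator_of_notMem hz] at this
    rw [ENNReal.ofReal_of_nonpos this]
    exact zero_le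

namespace Grid.Fits

variable {d : ℕ} {G : Grid d} {U : Set (SpaceTime d)} {𝒟 : Set (BackwardRect d)}
  {μ : Measure (SpaceTime d)}

/-- Exactly one grid rectangle per generation contains `w`; if it is not in `𝒟`, it has no mass and
may be included. -/
theorem dyadicPotential_eq (hG : G.Fits U 𝒟) (hμ : μ Uᶜ = 0) (α : ℝ) (w : SpaceTime d) :
    dyadicPotential α 𝒟 μ w = ∑' j, ENNReal.ofReal (G.scale j) ^ (α - ((d : ℝ) + 2)) *
      μ (G.cell j ⁻¹' {G.cell j w}) := by
  rw [dyadicPotential, hG.tsum_eq fun R => ENNReal.ofReal (R.side ^ (α - ((d : ℝ) + 2))) *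
    μ R.toSet * R.toSet.indicator (fun _ => (1 : ℝ≥0∞)) w]
  refine tsum_congr fun j => ?_
  rw [tsum_eq_single (G.cell j w)]
  · have hw : w ∈ (G.rect j (G.cell j w)).toSet := G.mem_rect.2 rfl
    rcases hG.rect_mem_or_measure_eq_zero hμ j (G.cell j w) with h | h
    · rw [indicator_of_mem h, indicator_of_mem hw, mul_one, G.toSet_rect, rect_side,
        ENNReal.ofReal_rpow_of_pos (G.scale_pos j)]
    · by_cases h' : G.rect j (G.cell j w) ∈ 𝒟 <;> simp [h', h, G.toSet_rect]
  · intro κ hκ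
    have hw : w ∉ (G.rect j κ).toSet := fun hw => hκ (G.mem_rect.1 hw).symm
    by_cases h' : G.rect j κ ∈ 𝒟 <;> simp [h', hw]

theorem wolffEnergy_le_dyadicEnergy (hG : G.Fits U 𝒟) (hμ : μ Uᶜ = 0) (α : ℝ) {q : ℝ}
    (hq : 1 < q) : G.wolffEnergy α (conjExp q) μ ≤ dyadicEnergy α q 𝒟 μ := by
  have hp := one_lt_conjExp hq
  simp_rw [dyadicEnergy, hG.dyadicPotential_eq hμ, wolffEnergy,
    ← G.lintegral_scale_mul_measure_cell _ (zero_le_one.trans hp.le) α μ]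
  rw [← lintegral_tsum fun j =>
    (((G.measurable_measure_cell j μ).const_mul _).pow_const _).aemeasurable]
  exact lintegral_mono fun w => tsum_rpow_le_rpow_tsum hp _

/-- Integrating the last factor `η_R` against `μ` raises the power of `μ(η_R)` from `p - 1` to `p`.
The equality is exact, and it also yields homogeneity and lower semicontinuity of the energy. -/
theorem regEnergy_eq (hG : G.Fits U 𝒟) {η : BackwardRect d → SpaceTime d → ℝ}
    (hη : ∀ R ∈ 𝒟, IsCutoff R (η R)) (α : ℝ) {q : ℝ} (hq : 1 < q) :
    regEnergy α q 𝒟 η μ = ∑' j, ∑' κ, 𝒟.indicator (fun R =>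
      ENNReal.ofReal R.side ^ ((α - ((d : ℝ) + 2)) * conjExp q + ((d : ℝ) + 2)) *
        (∫⁻ z, ENNReal.ofReal (η R z) ∂μ) ^ conjExp q) (G.rect j κ) := by
  have := hG.countable
  have hp := one_lt_conjExp hq
  have hmeas : ∀ R : {R : BackwardRect d // R ∈ 𝒟 ∧ R.side < 1},
      Measurable fun z => ENNReal.ofReal (η R.1 z) := fun R =>
    (hη R.1 R.2.1).contDiff.continuous.measurable.ennreal_ofReal
  rw [← hG.tsum_eq, regEnergy]
  simp only [regWolffPotential]
  rw [lintegral_tsum fun R => ((hmeas R).const_mul _).aemeasurable]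
  refine tsum_congr fun R => ?_
  rw [lintegral_const_mul _ (hmeas R), ENNReal.mul_rpow_of_nonneg _ _ (by linarith), mul_assoc]
  congr 1
  · rw [← ENNReal.ofReal_rpow_of_pos R.1.side_pos, ← ENNReal.rpow_mul, conjExp_exponent hq]
  · nth_rw 2 [← ENNReal.rpow_one (∫⁻ z, ENNReal.ofReal (η R.1 z) ∂μ)]
    rw [← ENNReal.rpow_add_of_nonneg _ _ (by linarith) zero_le_one, sub_add_cancel]

theorem wolffEnergy_le_regEnergy (hG : G.Fits U 𝒟) (hμ : μ Uᶜ = 0)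
    {η : BackwardRect d → SpaceTime d → ℝ} (hη : ∀ R ∈ 𝒟, IsCutoff R (η R)) (α : ℝ) {q : ℝ}
    (hq : 1 < q) : G.wolffEnergy α (conjExp q) μ ≤ regEnergy α q 𝒟 η μ := by
  have hp := one_lt_conjExp hq
  rw [hG.regEnergy_eq hη α hq, wolffEnergy]
  refine ENNReal.tsum_le_tsum fun j => ?_
  rw [← ENNReal.tsum_mul_left]
  refine ENNReal.tsum_le_tsum fun κ => ?_
  by_cases h : G.rect j κ ∈ 𝒟
  · rw [indicator_of_mem h]
    exact mul_le_mul_right (ENNReal.rpow_le_rpow ((hη _ h).measure_le_lintegral μ) (by linarith)) _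
  · rw [(hG.rect_mem_or_measure_eq_zero hμ j κ).resolve_left h,
      ENNReal.zero_rpow_of_pos (by linarith)]
    simp

/-- Kept to one generation because the compactness argument for capacities controls only energies
truncated at a finite generation. -/
theorem regEnergy_term_le {η : BackwardRect d → SpaceTime d → ℝ}
    (hη : ∀ R ∈ 𝒟, IsCutoff R (η R)) (α : ℝ) {p : ℝ} (hp : 1 < p) (j : ℕ) :
    ∑' κ, 𝒟.indicator (fun R =>
      ENNReal.ofReal R.side ^ ((α - ((d : ℝ) + 2)) * p + ((d : ℝ) + 2)) *
        (∫⁻ z, ENNReal.ofReal (η R z) ∂μ) ^ p) (G.rect j κ) ≤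
      ((box d 9).card : ℝ≥0∞) ^ p *
        (ENNReal.ofReal (G.scale j) ^ ((α - (d + 2)) * p + (d + 2)) *
          ∑' κ, μ (G.cell j ⁻¹' {κ}) ^ p) := by
  rw [mul_left_comm]
  refine le_trans ?_ (mul_le_mul_right (G.tsum_nbhdMass_rpow_le hp μ 9 j) _)
  rw [← ENNReal.tsum_mul_left]
  refine ENNReal.tsum_le_tsum fun κ => ?_
  by_cases h : G.rect j κ ∈ 𝒟
  · rw [indicator_of_mem h]
    exact mul_le_mul_right (ENNReal.rpow_le_rpow ((hη _ h).lintegral_le_nbhdMass μ) (by linarith)) _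
  · simp [h]

theorem regEnergy_le_wolffEnergy (hG : G.Fits U 𝒟) {η : BackwardRect d → SpaceTime d → ℝ}
    (hη : ∀ R ∈ 𝒟, IsCutoff R (η R)) (α : ℝ) {q : ℝ} (hq : 1 < q) :
    regEnergy α q 𝒟 η μ ≤
      ((box d 9).card : ℝ≥0∞) ^ conjExp q * G.wolffEnergy α (conjExp q) μ := by
  rw [hG.regEnergy_eq hη α hq, wolffEnergy, ← ENNReal.tsum_mul_left]
  exact ENNReal.tsum_le_tsum fun j => regEnergy_term_le hη α (one_lt_conjExp hq) j

end Grid.Fits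

/-! ### Wolff's inequality -/

/-- The finer mass is written as a `μ`-integral over `z` and the integrals are exchanged. Points
that are neighbours at the fine generation are neighbours at the coarse one, so the coarse factor at
`w` is bounded by an enlarged one at `z`. The `w`-integral then gives the fine volume, leaving
`ℓ_{i+k}^α = 2^(-αk) ℓ_i^α`, and the rest is a sum over cells of generation `i`. -/
theorem Grid.lintegral_nbhdMass_mul_le {d : ℕ} (G : Grid d) {α p : ℝ} (hp : 1 < p)
    (μ : Measure (SpaceTime d)) [SFinite μ] (i k : ℕ) :
    ∫⁻ w, (ENNReal.ofReal (G.scale (i + k)) ^ (α - ((d : ℝ) + 2)) *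
        G.nbhdMass μ 1 (i + k) (G.cell (i + k) w)) *
      (ENNReal.ofReal (G.scale i) ^ (α - ((d : ℝ) + 2)) *
        G.nbhdMass μ 1 i (G.cell i w)) ^ (p - 1) ≤
    ENNReal.ofReal ((2 : ℝ) ^ (-α)) ^ k * ((box d 1).card * ((box d 2).card : ℝ≥0∞) ^ p *
      (ENNReal.ofReal (G.scale i) ^ ((α - (d + 2)) * p + (d + 2)) *
        ∑' κ, μ (G.cell i ⁻¹' {κ}) ^ p)) := by
  have hs : 0 ≤ p - 1 := by linarith
  set j := i + k with hj
  set li := ENNReal.ofReal (G.scale i) with hli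
  set lj := ENNReal.ofReal (G.scale j) with hlj
  have hli0 : li ≠ 0 := G.ofReal_scale_ne_zero i
  have hlj0 : lj ≠ 0 := G.ofReal_scale_ne_zero j
  have hlit : li ≠ ⊤ := ENNReal.ofReal_ne_top
  have hljt : lj ≠ ⊤ := ENNReal.ofReal_ne_top
  set E : Set (SpaceTime d × SpaceTime d) := {x | G.cell j x.2 - G.cell j x.1 ∈ box d 1} with hE
  have hEm : MeasurableSet E :=
    (((G.measurable_cell j).comp measurable_snd).sub ((G.measurable_cell j).comp measurable_fst))
      (box d 1).measurableSet
  set I : SpaceTime d × SpaceTime d → ℝ≥0∞ := E.indicator 1 with hIE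
  have hmi : ∀ m, Measurable fun w => G.nbhdMass μ m i (G.cell i w) := fun m =>
    (measurable_of_countable fun κ => G.nbhdMass μ m i κ).comp (G.measurable_cell i)
  have hmass : ∀ w, G.nbhdMass μ 1 j (G.cell j w) = ∫⁻ z, I (w, z) ∂μ := by
    intro w
    have : MeasurableSet {z | G.cell j z - G.cell j w ∈ box d 1} := measurable_prodMk_left hEm
    rw [Grid.nbhdMass, ← lintegral_indicator_one this]
    rfl
  have hvol : ∀ z, ∫⁻ w, I (w, z) = (box d 1).card * lj ^ ((d : ℝ) + 2) := by
    intro z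
    have h1 : ∀ w, I (w, z) =
        {w | G.cell j w - G.cell j z ∈ box d 1}.indicator 1 w := by
      intro w
      have : (w, z) ∈ E ↔ w ∈ {w | G.cell j w - G.cell j z ∈ box d 1} := by
        rw [hE, mem_ofPred_eq, mem_ofPred_eq, ← neg_mem_box, neg_sub]
      rw [hIE]
      by_cases h : (w, z) ∈ E
      · rw [indicator_of_mem h, indicator_of_mem (this.1 h)]; rfl
      · rw [indicator_of_notMem h, indicator_of_notMem (fun h' => h (this.2 h'))]
    have h2 : MeasurableSet {w | G.cell j w - G.cell j z ∈ box d 1} :=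
      (G.measurable_cell j).sub_const _
        (box d 1).measurableSet
    simp_rw [h1]
    rw [lintegral_indicator_one h2]
    change G.nbhdMass volume 1 j (G.cell j z) = _
    simp_rw [Grid.nbhdMass_eq, volume_cell]
    simp [hlj]
  have hI : Measurable I := measurable_one.indicator hEm
  set V : SpaceTime d → ℝ≥0∞ := fun w => (li ^ (α - ((d : ℝ) + 2)) *
        G.nbhdMass μ 1 i (G.cell i w)) ^ (p - 1) with hV
  have hVm : Measurable V := ((hmi 1).const_mul _).pow_const _
  -- The box has size `2 = 1 + 1`: one step from `w` to `z`, one step of the original neighbourhood.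
  set V' : SpaceTime d → ℝ≥0∞ := fun z => (li ^ (α - ((d : ℝ) + 2)) *
        G.nbhdMass μ 2 i (G.cell i z)) ^ (p - 1) with hV'
  have hVV' : ∀ w z, (w, z) ∈ E → V w ≤ V' z := by
    intro w z h
    simp only [hV, hV']
    gcongr
    refine measure_mono fun z' hz' => ?_
    have h1 : G.cell i z - G.cell i w ∈ box d 1 := G.cell_sub_mem_box_of_add h
    have := add_mem_box hz' (neg_mem_box.2 h1)
    simpa using this
  calc _ = ∫⁻ w, ∫⁻ z, lj ^ (α - ((d : ℝ) + 2)) * (I (w, z) * V w) ∂μ := by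
        refine lintegral_congr fun w => ?_
        have hm : Measurable fun z => I (w, z) :=
          hI.comp measurable_prodMk_left
        rw [lintegral_const_mul _ (hm.mul_const _), lintegral_mul_const _ hm, hmass, mul_assoc]
    _ = ∫⁻ z, (∫⁻ w, lj ^ (α - ((d : ℝ) + 2)) * (I (w, z) * V w)) ∂μ :=
        lintegral_lintegral_swap
          ((hI.mul (hVm.comp measurable_fst)).const_mul _).aemeasurable
    _ ≤ ∫⁻ z, (∫⁻ w, lj ^ (α - ((d : ℝ) + 2)) * (I (w, z) * V' z)) ∂μ := by
        refine lintegral_mono fun z => lintegral_mono fun w => mul_le_mul_right ?_ _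
        by_cases h : (w, z) ∈ E
        · gcongr
          exact hVV' w z h
        · simp [I, h]
    _ = ∫⁻ z, lj ^ (α - ((d : ℝ) + 2)) * ((box d 1).card * lj ^ ((d : ℝ) + 2)) * V' z ∂μ := by
        refine lintegral_congr fun z => ?_
        have hm : Measurable fun w => I (w, z) :=
          hI.comp measurable_prodMk_right
        rw [lintegral_const_mul _ (hm.mul_const _), lintegral_mul_const _ hm, hvol]
        ring
    _ = lj ^ α * (box d 1).card * ∫⁻ z, V' z ∂μ := by
        rw [lintegral_const_mul _ (((hmi 2).const_mul _).pow_const _)]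
        congr 1
        rw [mul_left_comm, ← ENNReal.rpow_add _ _ hlj0 hljt, sub_add_cancel, mul_comm]
    _ ≤ lj ^ α * (box d 1).card * (li ^ ((α - (d + 2)) * (p - 1)) *
          (((box d 2).card : ℝ≥0∞) ^ p * ∑' κ, μ (G.cell i ⁻¹' {κ}) ^ p)) := by
        gcongr
        refine le_trans ?_ (mul_le_mul_right (G.tsum_nbhdMass_rpow_le hp μ 2 i) _)
        rw [hV', G.lintegral_cell i μ (fun κ => (li ^ (α - ((d : ℝ) + 2)) *
          G.nbhdMass μ 2 i κ) ^ (p - 1)), ← ENNReal.tsum_mul_left]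
        refine ENNReal.tsum_le_tsum fun κ => ?_
        rw [ENNReal.mul_rpow_of_nonneg _ _ hs, ← ENNReal.rpow_mul, mul_assoc]
        gcongr
        calc _ ≤ G.nbhdMass μ 2 i κ ^ (p - 1) * G.nbhdMass μ 2 i κ ^ (1 : ℝ) := by
              rw [ENNReal.rpow_one]
              gcongr
              refine measure_mono fun z hz => ?_
              have hz' : G.cell i z = κ := hz
              simp [mem_box, hz']
          _ = _ := by rw [← ENNReal.rpow_add_of_nonneg _ _ hs zero_le_one, sub_add_cancel]
    _ = _ := by
        have h1 : lj ^ α = ENNReal.ofReal ((2 : ℝ) ^ (-α)) ^ k * li ^ α := by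
          rw [hlj, hli, ENNReal.ofReal_rpow_of_pos (G.scale_pos j),
            ENNReal.ofReal_rpow_of_pos (G.scale_pos i), ← ENNReal.ofReal_pow (by positivity),
            ← ENNReal.ofReal_mul (by positivity), hj, G.scale_add,
            Real.div_rpow (G.scale_pos i).le (by positivity), ← Real.rpow_natCast,
            ← Real.rpow_natCast, ← Real.rpow_mul two_pos.le, ← Real.rpow_mul two_pos.le,
            neg_mul, Real.rpow_neg two_pos.le, div_eq_inv_mul, mul_comm (k : ℝ)]
        have h2 : li ^ ((α - ((d : ℝ) + 2)) * p + ((d : ℝ) + 2)) =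
            li ^ α * li ^ ((α - ((d : ℝ) + 2)) * (p - 1)) := by
          rw [← ENNReal.rpow_add _ _ hli0 hlit]
          congr 1; ring
        rw [h1, h2]
        ring

/-- **Wolff's inequality** for a dyadic potential whose terms are enlarged to neighbourhoods of the
dyadic rectangles. -/
theorem exists_lintegral_nbhdPotential_le (d : ℕ) {α p : ℝ} (hα : 0 < α) (hp : 1 < p) :
    ∃ C : ℝ≥0, ∀ (G : Grid d) (μ : Measure (SpaceTime d)) [SFinite μ],
      ∫⁻ w, (∑' j, ENNReal.ofReal (G.scale j) ^ (α - ((d : ℝ) + 2)) *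
        G.nbhdMass μ 1 j (G.cell j w)) ^ p ≤ C * G.wolffEnergy α p μ := by
  obtain ⟨C, hC⟩ := exists_lintegral_tsum_rpow_le hp (r := (2 : ℝ) ^ (-α)) (by positivity)
    (Real.rpow_lt_one_of_one_lt_of_neg one_lt_two (by linarith))
  have hD : (C : ℝ≥0∞) * ((box d 1).card * ((box d 2).card : ℝ≥0∞) ^ p) ≠ ⊤ :=
    ENNReal.mul_ne_top ENNReal.coe_ne_top (ENNReal.mul_ne_top (ENNReal.natCast_ne_top _)
      (ENNReal.rpow_ne_top_of_nonneg (by linarith) (ENNReal.natCast_ne_top _)))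
  refine ⟨((C : ℝ≥0∞) * ((box d 1).card * ((box d 2).card : ℝ≥0∞) ^ p)).toNNReal,
    fun G μ _ => ?_⟩
  rw [ENNReal.coe_toNNReal hD]
  have h := hC volume _ _ (fun j => ((measurable_of_countable fun κ => G.nbhdMass μ 1 j κ).comp
    (G.measurable_cell j)).const_mul (ENNReal.ofReal (G.scale j) ^ (α - ((d : ℝ) + 2))))
    (fun i k => G.lintegral_nbhdMass_mul_le (α := α) hp μ i k)
  refine h.trans_eq ?_
  rw [ENNReal.tsum_mul_left, Grid.wolffEnergy]
  ring

theorem Grid.Fits.dyadicEnergy_le {d : ℕ} {G : Grid d} {U : Set (SpaceTime d)}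
    {𝒟 : Set (BackwardRect d)} {μ : Measure (SpaceTime d)} (hG : G.Fits U 𝒟) (hμ : μ Uᶜ = 0)
    (α : ℝ) {q : ℝ} (hq : 1 < q) :
    dyadicEnergy α q 𝒟 μ ≤ ∫⁻ w, (∑' j, ENNReal.ofReal (G.scale j) ^ (α - ((d : ℝ) + 2)) *
        G.nbhdMass μ 1 j (G.cell j w)) ^ conjExp q := by
  have hp := one_lt_conjExp hq
  simp_rw [dyadicEnergy, hG.dyadicPotential_eq hμ]
  gcongr with w j
  refine measure_mono fun z hz => ?_
  have hz' : G.cell j z = G.cell j w := hz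
  simp [mem_box, hz']

/-! ### Bounds for the parabolic Bessel kernel -/

theorem measurable_besselKernel (d : ℕ) (α : ℝ) :
    Measurable (besselKernel α : SpaceTime d → ℝ) := by
  unfold besselKernel
  refine Measurable.ite (measurableSet_lt measurable_const measurable_snd) ?_ measurable_const
  fun_prop

theorem besselKernel_nonneg {d : ℕ} {α : ℝ} (hα : 0 < α) (z : SpaceTime d) :
    0 ≤ besselKernel α z := by
  unfold besselKernel
  split_ifs with h
  · have := Real.Gamma_pos_of_pos (half_pos hα)
    positivity
  · rfl

/-- The normalizing constant of the parabolic Bessel kernel. -/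
noncomputable def besselConst (d : ℕ) (α : ℝ) : ℝ :=
  (4 * Real.pi) ^ (-(d : ℝ) / 2) * (Real.Gamma (α / 2))⁻¹

theorem besselConst_pos (d : ℕ) {α : ℝ} (hα : 0 < α) : 0 < besselConst d α := by
  have := Real.Gamma_pos_of_pos (half_pos hα)
  unfold besselConst
  positivity

/-- From `x ≤ exp x` at `x = y / (8a)`. The rate `1/8` is half the Gaussian rate `1/4`, leaving the
other half for decay at infinity. -/
theorem rpow_le_mul_exp {a y : ℝ} (ha : 0 < a) (hy : 0 ≤ y) :
    y ^ a ≤ (8 * a) ^ a * Real.exp (y / 8) := by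
  have h1 : y / (8 * a) ≤ Real.exp (y / (8 * a)) := by
    linarith [Real.add_one_le_exp (y / (8 * a))]
  have h2 := Real.rpow_le_rpow (by positivity) h1 ha.le
  rw [Real.div_rpow hy (by positivity), ← Real.exp_mul, div_le_iff₀ (by positivity)] at h2
  refine h2.trans_eq ?_
  rw [mul_comm]
  congr 2
  field_simp

/-- Half of the Gaussian turns `t^(-a)` into `(t + |x|²)^(-a)`; the other half, with `exp (-t)`,
gives exponential decay in `t + |x|`. The radius `ρ` is free so that the bound serves at every
dyadic scale and at unit scale. -/
theorem exists_besselKernel_le (d : ℕ) {α : ℝ} (hα : 0 < α) (hαn : α < (d : ℝ) + 2) :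
    ∃ K : ℝ, 0 < K ∧ ∀ (z : SpaceTime d) (ρ : ℝ), 0 < z.2 → 0 < ρ → ρ ^ 2 ≤ z.2 + ‖z.1‖ ^ 2 →
      besselKernel α z ≤ K * ρ ^ (α - ((d : ℝ) + 2)) * Real.exp (-(z.2 + ‖z.1‖) / 4) := by
  have hA := besselConst_pos d hα
  set a : ℝ := ((d : ℝ) + 2 - α) / 2 with ha
  have ha0 : 0 < a := by rw [ha]; linarith
  refine ⟨besselConst d α * ((8 * a) ^ a * Real.exp (1 / 8)), by positivity, ?_⟩
  rintro ⟨x, t⟩ ρ ht hρ hρt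
  simp only at ht hρt ⊢
  set X := ‖x‖ with hX
  have hX0 : 0 ≤ X := norm_nonneg x
  have hker : besselKernel α (x, t) = besselConst d α *
      (t ^ (-a) * Real.exp (-(X ^ 2 / (8 * t)))) * Real.exp (-t - X ^ 2 / (8 * t)) := by
    rw [besselKernel, if_pos ht, besselConst]
    simp only
    have h1 : -((d : ℝ) + 2 - α) / 2 = -a := by rw [ha]; ring
    have h2 : -t - ‖x‖ ^ 2 / (4 * t) = -(X ^ 2 / (8 * t)) + (-t - X ^ 2 / (8 * t)) := by
      rw [hX]; field_simp; ring
    rw [h1, h2, Real.exp_add]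
    ring
  have h3 : t ^ (-a) * Real.exp (-(X ^ 2 / (8 * t))) ≤
      ((8 * a) ^ a * Real.exp (1 / 8)) * ρ ^ (α - ((d : ℝ) + 2)) := by
    have hs : 0 < t + X ^ 2 := by positivity
    have h4 : t ^ (-a) = (t + X ^ 2) ^ (-a) * ((t + X ^ 2) / t) ^ a := by
      rw [Real.div_rpow hs.le ht.le, Real.rpow_neg hs.le, Real.rpow_neg ht.le]
      have := (Real.rpow_pos_of_pos hs a).ne'
      field_simp
    have h5 := rpow_le_mul_exp ha0 (div_nonneg hs.le ht.le)
    have h6 : (t + X ^ 2) / t / 8 = 1 / 8 + X ^ 2 / (8 * t) := by field_simp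
    rw [h6, Real.exp_add] at h5
    have h7 : (t + X ^ 2) ^ (-a) ≤ ρ ^ (α - ((d : ℝ) + 2)) := by
      have h8 : ρ ^ (α - ((d : ℝ) + 2)) = (ρ ^ 2) ^ (-a) := by
        rw [← Real.rpow_natCast ρ 2, ← Real.rpow_mul hρ.le]
        congr 1; rw [ha]; push_cast; ring
      rw [h8]
      exact Real.rpow_le_rpow_of_nonpos (by positivity) hρt (by linarith)
    calc t ^ (-a) * Real.exp (-(X ^ 2 / (8 * t)))
        = (t + X ^ 2) ^ (-a) * (((t + X ^ 2) / t) ^ a * Real.exp (-(X ^ 2 / (8 * t)))) := by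
          rw [h4]; ring
      _ ≤ ρ ^ (α - ((d : ℝ) + 2)) * ((8 * a) ^ a * (Real.exp (1 / 8) *
            Real.exp (X ^ 2 / (8 * t))) * Real.exp (-(X ^ 2 / (8 * t)))) := by gcongr
      _ = _ := by
          rw [Real.exp_neg]
          field_simp
  -- Completing the square.
  have h9 : -t - X ^ 2 / (8 * t) ≤ -(t + X) / 4 := by
    have : -(t + X) / 4 - (-t - X ^ 2 / (8 * t)) = ((X - t) ^ 2 + 5 * t ^ 2) / (8 * t) := by
      field_simp; ring
    have : 0 ≤ ((X - t) ^ 2 + 5 * t ^ 2) / (8 * t) := by positivity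
    linarith
  rw [hker]
  calc _ ≤ besselConst d α * (((8 * a) ^ a * Real.exp (1 / 8)) * ρ ^ (α - ((d : ℝ) + 2))) *
        Real.exp (-(t + X) / 4) := by gcongr
    _ = _ := by ring

/-- On this window the exponent is bounded below because `|x|² / t ≤ d` and `ℓ < 1`. After a time
translation by `2ℓ²`, a cell of height `ℓ²` is seen with time gap between `ℓ²` and `3ℓ²`. -/
theorem exists_le_besselKernel (d : ℕ) {α : ℝ} (hα : 0 < α) (hαn : α < (d : ℝ) + 2) :
    ∃ c : ℝ, 0 < c ∧ ∀ (z : SpaceTime d) (ℓ : ℝ), 0 < ℓ → ℓ < 1 → (∀ i, |z.1 i| ≤ ℓ) →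
      ℓ ^ 2 ≤ z.2 → z.2 ≤ 3 * ℓ ^ 2 → c * ℓ ^ (α - ((d : ℝ) + 2)) ≤ besselKernel α z := by
  have hA := besselConst_pos d hα
  set a : ℝ := ((d : ℝ) + 2 - α) / 2 with ha
  have ha0 : 0 < a := by rw [ha]; linarith
  refine ⟨besselConst d α * (3 ^ (-a) * Real.exp (-3 - d / 4)), by positivity, ?_⟩
  rintro ⟨x, t⟩ ℓ hℓ hℓ1 hx ht1 ht2
  simp only at hx ht1 ht2
  have ht : 0 < t := lt_of_lt_of_le (by positivity) ht1
  have h1 : -((d : ℝ) + 2 - α) / 2 = -a := by rw [ha]; ring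
  have hX : ‖x‖ ^ 2 ≤ d * ℓ ^ 2 := by
    rw [EuclideanSpace.norm_sq_eq]
    calc ∑ i, ‖x i‖ ^ 2 ≤ ∑ _i : Fin d, ℓ ^ 2 := by
          gcongr with i
          simpa using hx i
      _ = _ := by simp
  have h2 : -3 - (d : ℝ) / 4 ≤ -t - ‖x‖ ^ 2 / (4 * t) := by
    have h3 : ‖x‖ ^ 2 / (4 * t) ≤ d / 4 := by
      rw [div_le_div_iff₀ (by positivity) (by norm_num)]
      have : (d : ℝ) * ℓ ^ 2 ≤ d * t := by gcongr
      nlinarith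
    have : ℓ ^ 2 < 1 := by nlinarith
    linarith
  have h4 : 3 ^ (-a) * ℓ ^ (α - ((d : ℝ) + 2)) ≤ t ^ (-a) := by
    have h8 : ℓ ^ (α - ((d : ℝ) + 2)) = (ℓ ^ 2) ^ (-a) := by
      rw [← Real.rpow_natCast ℓ 2, ← Real.rpow_mul hℓ.le]
      congr 1; rw [ha]; push_cast; ring
    rw [h8, ← Real.mul_rpow (by norm_num) (by positivity)]
    exact Real.rpow_le_rpow_of_nonpos ht ht2 (by linarith)
  rw [besselKernel, if_pos ht, h1]
  change _ ≤ besselConst d α * t ^ (-a) * Real.exp (-t - ‖x‖ ^ 2 / (4 * t))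
  calc _ = besselConst d α * (3 ^ (-a) * ℓ ^ (α - ((d : ℝ) + 2))) * Real.exp (-3 - d / 4) := by ring
    _ ≤ _ := by gcongr

theorem summable_exp_neg_abs {c : ℝ} (hc : 0 < c) :
    Summable fun k : ℤ => Real.exp (-c * (|(k : ℝ)| - 1)) := by
  have h : Summable fun n : ℕ => Real.exp (-c * ((n : ℝ) - 1)) := by
    have h1 := (Real.summable_exp_nat_mul_iff (a := -c)).2 (by linarith)
    refine (h1.mul_left (Real.exp c)).congr fun n => ?_
    rw [← Real.exp_add]; congr 1; ring
  refine Summable.of_nat_of_neg (h.congr fun n => ?_) (h.congr fun n => ?_) <;> simp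

theorem abs_floor_sub_floor_le (x y : ℝ) : |((⌊x⌋ - ⌊y⌋ : ℤ) : ℝ)| ≤ |x - y| + 1 := by
  have h1 := Int.floor_le x
  have h2 := Int.lt_floor_add_one x
  have h3 := Int.floor_le y
  have h4 := Int.lt_floor_add_one y
  have h5 := le_abs_self (x - y)
  have h6 := neg_abs_le (x - y)
  push_cast
  rw [abs_le]
  constructor <;> linarith

namespace Grid

variable {d : ℕ} (G : Grid d)

/-- Time translation by twice the height of the rectangles of generation `j`. -/
noncomputable def shift (j : ℕ) (w : SpaceTime d) : SpaceTime d := w + (0, 2 * G.scale j ^ 2)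

theorem cell_sub_fst_le (j : ℕ) (z w : SpaceTime d) (i : Fin d) :
    |(((G.cell j z - G.cell j w).1 i : ℤ) : ℝ)| ≤ |z.1 i - w.1 i| / G.scale j + 1 := by
  have hl := G.scale_pos j
  refine (abs_floor_sub_floor_le _ _).trans_eq ?_
  rw [← sub_div, abs_div, abs_of_pos hl]
  congr 3; ring

theorem cell_sub_snd_le (j : ℕ) (z w : SpaceTime d) :
    |(((G.cell j z - G.cell j w).2 : ℤ) : ℝ)| ≤ |z.2 - w.2| / G.scale j ^ 2 + 1 := by
  have hl : 0 < G.scale j ^ 2 := by have := G.scale_pos j; positivity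
  refine (abs_floor_sub_floor_le _ _).trans_eq ?_
  rw [← sub_div, abs_div, abs_of_pos hl]
  congr 3; ring

theorem cell_sub_mem_box_one {j : ℕ} {z w : SpaceTime d}
    (h1 : ∀ i, |z.1 i - w.1 i| < G.scale j) (h2 : |z.2 - w.2| < G.scale j ^ 2) :
    G.cell j z - G.cell j w ∈ box d 1 := by
  have hl := G.scale_pos j
  have key : ∀ (k : ℤ) (r s : ℝ), 0 < s → r < s → |(k : ℝ)| ≤ r / s + 1 → |k| ≤ 1 := by
    intro k r s hs hrs hk
    have : r / s < 1 := (div_lt_one hs).2 hrs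
    have h3 : |(k : ℝ)| < 2 := by linarith
    have h4 : |k| < 2 := by exact_mod_cast h3
    omega
  rw [mem_box]
  exact ⟨fun i => key _ _ _ hl (h1 i) (G.cell_sub_fst_le j z w i),
    key _ _ _ (by positivity) h2 (G.cell_sub_snd_le j z w)⟩

theorem abs_sub_lt_of_cell_eq {j : ℕ} {z w : SpaceTime d} (h : G.cell j z = G.cell j w) :
    (∀ i, |z.1 i - w.1 i| < G.scale j) ∧ |z.2 - w.2| < G.scale j ^ 2 := by
  have hl := G.scale_pos j
  have hl2 : 0 < G.scale j ^ 2 := by positivity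
  have key : ∀ x y c s : ℝ, 0 < s → ⌊(x - c) / s⌋ = ⌊(y - c) / s⌋ → |x - y| < s := by
    intro x y c s hs hxy
    have := Int.abs_sub_lt_one_of_floor_eq_floor hxy
    rwa [← sub_div, sub_sub_sub_cancel_right, abs_div, abs_of_pos hs, div_lt_one hs] at this
  exact ⟨fun i => key _ _ _ _ hl (congrFun (congrArg Prod.fst h) i),
    key _ _ _ _ hl2 (congrArg Prod.snd h)⟩

end Grid

/-- The parabolic Bessel kernel is at most a sum of dyadic kernels and a summable kernel at unit
scale. -/
theorem exists_besselKernel_le_tsum (d : ℕ) {α : ℝ} (hα : 0 < α) (hαn : α < (d : ℝ) + 2) :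
    ∃ (K : ℝ≥0) (b : Index d → ℝ≥0∞), ∑' v, b v ≠ ⊤ ∧ ∀ (G : Grid d) (z w : SpaceTime d),
      ENNReal.ofReal (besselKernel α (z - w)) ≤
        K * (∑' j, ENNReal.ofReal (G.scale j) ^ (α - ((d : ℝ) + 2)) *
          {z | G.cell j z - G.cell j w ∈ box d 1}.indicator 1 z) +
        b (G.cell 0 z - G.cell 0 w) := by
  obtain ⟨K, hK, hker⟩ := exists_besselKernel_le d hα hαn
  -- The factor `(1/2)^(α-n)` serves twice: it passes from scale `j + 1` to scale `j`, and it is the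
  -- kernel bound at the radius `1/2` of the far part.
  set D : ℝ := K * (1 / 2) ^ (α - ((d : ℝ) + 2)) with hD
  have hD0 : 0 < D := by positivity
  -- As the coarsest side is at least `1/2`, labels differ by at most `2‖x‖ + 1` in space and `4t +
  -- 1` in time. The excesses over one, summed over `d + 1` coordinates, are at most `4(d+1)(t +
  -- ‖x‖)`, so the product of one-variable weights stays above `exp (-(t + ‖x‖)/4)`.
  set c : ℝ := 1 / (16 * (d + 1)) with hc
  have hc0 : 0 < c := by positivity
  set β : ℤ → ℝ≥0∞ := fun k => ENNReal.ofReal (Real.exp (-c * (|(k : ℝ)| - 1))) with hβ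
  have hβs : ∑' k, β k ≠ ⊤ := (summable_exp_neg_abs hc0).tsum_ofReal_ne_top
  refine ⟨D.toNNReal, fun v => ENNReal.ofReal D * ((∏ i, β (v.1 i)) * β v.2), ?_, ?_⟩
  · rw [ENNReal.tsum_mul_left, ENNReal.tsum_prod']
    simp_rw [ENNReal.tsum_mul_left, ENNReal.tsum_mul_right, tsum_pi_fin_prod]
    exact ENNReal.mul_ne_top ENNReal.ofReal_ne_top
      (ENNReal.mul_ne_top (ENNReal.pow_ne_top hβs) hβs)
  intro G z w
  rcases le_or_gt (z - w).2 0 with ht | ht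
  · rw [besselKernel, if_neg ht.not_gt]
    simp
  set x := (z - w).1 with hx
  have hxi : ∀ i, z.1 i - w.1 i = x i := fun i => by simp [hx]
  have hxn : ∀ i, |x i| ≤ ‖x‖ := fun i => PiLp.norm_apply_le x i
  set t := (z - w).2 with ht'
  have hti : z.2 - w.2 = t := by simp [ht']
  -- The first generation too small for the displacement decides the case. If it is `0`, the points
  -- are far apart and the tail `b` applies; if it is `j + 1`, they are neighbours at generation `j`
  -- and their parabolic distance is at least the scale `j + 1`.
  have hfail : ∃ j, ¬ ((∀ i, |x i| < G.scale j) ∧ t < G.scale j ^ 2) := by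
    obtain ⟨j, hj⟩ := exists_pow_lt_of_lt_one ht (show (1 / 2 : ℝ) < 1 by norm_num)
    refine ⟨j, fun h => ?_⟩
    have h1 : G.scale j ≤ (1 / 2) ^ j := by
      rw [Grid.scale, div_pow, one_pow]
      gcongr
      exact G.lt_one.le
    nlinarith [h.2, G.scale_lt_one j, G.scale_pos j]
  have hlow : ∀ j, ¬ ((∀ i, |x i| < G.scale j) ∧ t < G.scale j ^ 2) →
      G.scale j ^ 2 ≤ t + ‖x‖ ^ 2 := by
    intro j h
    have hl := G.scale_pos j
    by_cases h1 : ∀ i, |x i| < G.scale j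
    · have : G.scale j ^ 2 ≤ t := not_lt.1 fun h2 => h ⟨h1, h2⟩
      nlinarith [sq_nonneg ‖x‖]
    · push Not at h1
      obtain ⟨i, hi⟩ := h1
      nlinarith [hi.trans (hxn i)]
  classical
  rcases hj : Nat.find hfail with _ | j
  · refine le_add_left ?_
    have h0 := Nat.find_spec hfail
    rw [hj] at h0
    have hl : 1 / 2 ≤ G.scale 0 := by rw [G.scale_zero]; exact G.half_le
    have h1 := hker (z - w) (1 / 2) ht one_half_pos
      (le_trans (by gcongr) (hlow 0 h0))
    rw [← hD] at h1
    refine (ENNReal.ofReal_le_ofReal h1).trans ?_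
    rw [ENNReal.ofReal_mul hD0.le]
    refine mul_le_mul_right ?_ _
    rw [← ENNReal.ofReal_prod_of_nonneg fun _ _ => (Real.exp_pos _).le,
      ← ENNReal.ofReal_mul (Finset.prod_nonneg fun _ _ => (Real.exp_pos _).le), ← Real.exp_sum,
      ← Real.exp_add]
    refine ENNReal.ofReal_le_ofReal (Real.exp_le_exp.2 ?_)
    have h2 : ∀ i, |(((G.cell 0 z - G.cell 0 w).1 i : ℤ) : ℝ)| - 1 ≤ 2 * ‖x‖ := by
      intro i
      have h3 := G.cell_sub_fst_le 0 z w i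
      rw [hxi] at h3
      have h4 : |x i| / G.scale 0 ≤ 2 * ‖x‖ := by
        rw [div_le_iff₀ (G.scale_pos 0)]
        nlinarith [hxn i, norm_nonneg x]
      linarith
    have h5 : |(((G.cell 0 z - G.cell 0 w).2 : ℤ) : ℝ)| - 1 ≤ 4 * t := by
      have h3 := G.cell_sub_snd_le 0 z w
      rw [hti, abs_of_pos ht] at h3
      have h4 : t / G.scale 0 ^ 2 ≤ 4 * t := by
        have : 1 / 4 ≤ G.scale 0 ^ 2 := by nlinarith
        rw [div_le_iff₀ (pow_pos (G.scale_pos 0) 2)]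
        nlinarith
      linarith
    have h6 : ∑ i, (|(((G.cell 0 z - G.cell 0 w).1 i : ℤ) : ℝ)| - 1) ≤ d * (2 * ‖x‖) := by
      refine (Finset.sum_le_sum fun i _ => h2 i).trans_eq ?_
      simp
    rw [← Finset.mul_sum]
    have h7 : c * (16 * (d + 1)) = 1 := by rw [hc]; field_simp
    have hd : (0 : ℝ) ≤ d := Nat.cast_nonneg d
    have h8 := mul_le_mul_of_nonneg_left (add_le_add h6 h5) hc0.le
    have h9 : c * (d * (2 * ‖x‖) + 4 * t) ≤ (t + ‖x‖) / 4 := by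
      have : (t + ‖x‖) / 4 = c * (16 * (d + 1)) * ((t + ‖x‖) / 4) := by rw [h7, one_mul]
      rw [this, mul_assoc]
      refine mul_le_mul_of_nonneg_left ?_ hc0.le
      nlinarith [norm_nonneg x, mul_nonneg hd (norm_nonneg x), mul_nonneg hd ht.le]
    change -(t + ‖x‖) / 4 ≤ _
    linarith
  · refine le_add_right ?_
    have h0 : (∀ i, |x i| < G.scale j) ∧ t < G.scale j ^ 2 :=
      not_not.1 (Nat.find_min hfail (by omega : j < Nat.find hfail))
    have h1 := Nat.find_spec hfail
    rw [hj] at h1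
    have hmem : z ∈ {z | G.cell j z - G.cell j w ∈ box d 1} :=
      G.cell_sub_mem_box_one (fun i => by rw [hxi]; exact h0.1 i)
        (by rw [hti, abs_of_pos ht]; exact h0.2)
    have h2 := hker (z - w) (G.scale (j + 1)) ht (G.scale_pos _) (hlow _ h1)
    have h3 : besselKernel α (z - w) ≤ D * G.scale j ^ (α - ((d : ℝ) + 2)) := by
      refine h2.trans ?_
      have h4 : Real.exp (-((z - w).2 + ‖(z - w).1‖) / 4) ≤ 1 := by
        rw [Real.exp_le_one_iff]
        have := norm_nonneg (z - w).1
        linarith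
      refine (mul_le_of_le_one_right (by have := G.scale_pos (j + 1); positivity) h4).trans_eq ?_
      rw [hD, mul_assoc, ← Real.mul_rpow (by norm_num) (G.scale_pos j).le, G.scale_add, pow_one,
        div_eq_inv_mul, one_div]
    calc _ ≤ ENNReal.ofReal (D * G.scale j ^ (α - ((d : ℝ) + 2))) := ENNReal.ofReal_le_ofReal h3
      _ = D.toNNReal * (ENNReal.ofReal (G.scale j) ^ (α - ((d : ℝ) + 2)) *
          {z | G.cell j z - G.cell j w ∈ box d 1}.indicator 1 z) := by
        rw [indicator_of_mem hmem, ENNReal.ofReal_mul hD0.le,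
          ENNReal.ofReal_rpow_of_pos (G.scale_pos j)]
        simp [ENNReal.ofReal]
      _ ≤ _ := by
        gcongr
        exact ENNReal.le_tsum (f := fun j => ENNReal.ofReal (G.scale j) ^ (α - ((d : ℝ) + 2)) *
          {z | G.cell j z - G.cell j w ∈ box d 1}.indicator 1 z) j

/-- The kernel is not bounded below on pairs in a common cell, since it vanishes for nonpositive
time differences; the time translation repairs this. At most one generation contributes for given
`z` and `w`: the time gap lies in `(ℓ_j², 3ℓ_j²)`, and these windows are disjoint because `ℓ_j²`
drops by a factor `4`. -/
theorem exists_tsum_le_besselKernel (d : ℕ) {α : ℝ} (hα : 0 < α) (hαn : α < (d : ℝ) + 2) :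
    ∃ c : ℝ≥0, c ≠ 0 ∧ ∀ (G : Grid d) (z w : SpaceTime d),
      c * (∑' j, ENNReal.ofReal (G.scale j) ^ (α - ((d : ℝ) + 2)) *
        {z | G.cell j z = G.cell j (G.shift j w)}.indicator 1 z) ≤
        ENNReal.ofReal (besselKernel α (z - w)) := by
  obtain ⟨c, hc, hker⟩ := exists_le_besselKernel d hα hαn
  refine ⟨c.toNNReal, by simpa using hc, fun G z w => ?_⟩
  have hwin : ∀ j, G.cell j z = G.cell j (G.shift j w) → (∀ i, |(z - w).1 i| < G.scale j) ∧
      G.scale j ^ 2 < (z - w).2 ∧ (z - w).2 < 3 * G.scale j ^ 2 := by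
    intro j hj
    obtain ⟨h1, h2⟩ := G.abs_sub_lt_of_cell_eq hj
    simp only [Grid.shift, Prod.fst_add, Prod.snd_add, add_zero] at h1 h2
    rw [abs_lt] at h2
    refine ⟨h1, ?_, ?_⟩ <;> simp only [Prod.snd_sub] <;> linarith
  by_cases hex : ∃ j, G.cell j z = G.cell j (G.shift j w)
  · obtain ⟨j, hj⟩ := hex
    have huniq : ∀ i, i ≠ j → G.cell i z ≠ G.cell i (G.shift i w) := by
      intro i hij hi
      obtain ⟨-, h1, h2⟩ := hwin i hi
      obtain ⟨-, h3, h4⟩ := hwin j hj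
      have key : ∀ a b : ℕ, a < b → 4 * G.scale b ^ 2 ≤ G.scale a ^ 2 := by
        intro a b hab
        obtain ⟨k, rfl⟩ := Nat.exists_eq_add_of_lt hab
        rw [add_assoc, G.scale_add, div_pow, ← pow_mul, mul_div_assoc', div_le_iff₀ (by positivity)]
        have : (4 : ℝ) ≤ 2 ^ ((k + 1) * 2) := by
          calc (4 : ℝ) = 2 ^ 2 := by norm_num
            _ ≤ _ := pow_le_pow_right₀ one_le_two (by omega)
        nlinarith [sq_nonneg (G.scale a)]
      rcases lt_or_gt_of_ne hij with h | h
      · linarith [key _ _ h, sq_nonneg (G.scale j)]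
      · linarith [key _ _ h, sq_nonneg (G.scale i)]
    rw [tsum_eq_single j]
    · obtain ⟨h1, h2, h3⟩ := hwin j hj
      have := hker (z - w) (G.scale j) (G.scale_pos j) (G.scale_lt_one j) (fun i => (h1 i).le)
        h2.le h3.le
      refine le_trans (le_of_eq ?_) (ENNReal.ofReal_le_ofReal this)
      rw [indicator_of_mem (show z ∈ {z | G.cell j z = G.cell j (G.shift j w)} from hj),
        ENNReal.ofReal_mul hc.le, ENNReal.ofReal_rpow_of_pos (G.scale_pos j)]
      simp [ENNReal.ofReal]
    · intro i hij
      rw [indicator_of_notMem (show z ∉ {z | G.cell i z = G.cell i (G.shift i w)} from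
        huniq i hij), mul_zero]
  · push Not at hex
    simp [hex]

/-! ### Comparison of the Bessel energy with the Wolff energy -/

theorem Grid.lintegral_comp_shift {d : ℕ} (G : Grid d) (j : ℕ) (g : SpaceTime d → ℝ≥0∞) :
    ∫⁻ w, g (G.shift j w) = ∫⁻ w, g w := by
  have : (volume : Measure (SpaceTime d)).IsAddHaarMeasure := by
    rw [Measure.volume_eq_prod]; infer_instance
  exact lintegral_add_right_eq_self g _

/-- The near part of the kernel is handled by Wolff's inequality. The tail gives a convolution over
the labels of generation `0`, so Young's inequality bounds it by a single generation of the Wolff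
energy. -/
theorem exists_besselEnergy_le (d : ℕ) {α p : ℝ} (hα : 0 < α) (hαn : α < (d : ℝ) + 2)
    (hp : 1 < p) :
    ∃ C : ℝ≥0, ∀ (G : Grid d) (μ : Measure (SpaceTime d)) [SFinite μ],
      ∫⁻ w, backwardBesselPotential α μ w ^ p ≤ C * G.wolffEnergy α p μ := by
  obtain ⟨K, b, hb, hker⟩ := exists_besselKernel_le_tsum d hα hαn
  obtain ⟨C, hC⟩ := exists_lintegral_nbhdPotential_le d hα hp
  have hp0 : 0 < p := by linarith
  set D : ℝ≥0∞ := 2 ^ (p - 1) * ((K : ℝ≥0∞) ^ p * C + (∑' v, b v) ^ p) with hD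
  have hDt : D ≠ ⊤ := by
    refine ENNReal.mul_ne_top (ENNReal.rpow_ne_top_of_nonneg (by linarith) (by simp))
      (ENNReal.add_ne_top.2 ⟨ENNReal.mul_ne_top (ENNReal.rpow_ne_top_of_nonneg hp0.le (by simp))
        (by simp), ENNReal.rpow_ne_top_of_nonneg hp0.le hb⟩)
  refine ⟨D.toNNReal, fun G μ _ => ?_⟩
  rw [ENNReal.coe_toNNReal hDt]
  have hm : ∀ (j : ℕ) (w : SpaceTime d),
      MeasurableSet {z | G.cell j z - G.cell j w ∈ box d 1} := fun j w =>
    (G.measurable_cell j).sub_const _ (box d 1).measurableSet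
  have hmn : Measurable fun w => ∑' j, ENNReal.ofReal (G.scale j) ^ (α - ((d : ℝ) + 2)) *
      G.nbhdMass μ 1 j (G.cell j w) := Measurable.tsum fun j =>
    ((measurable_of_countable fun κ => G.nbhdMass μ 1 j κ).comp (G.measurable_cell j)).const_mul _
  have hpot : ∀ w, backwardBesselPotential α μ w ≤
      K * (∑' j, ENNReal.ofReal (G.scale j) ^ (α - ((d : ℝ) + 2)) *
        G.nbhdMass μ 1 j (G.cell j w)) +
      ∑' v, b v * μ (G.cell 0 ⁻¹' {G.cell 0 w + v}) := by
    intro w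
    refine (lintegral_mono fun z => hker G z w).trans_eq ?_
    have hm1 : ∀ j, Measurable fun z => ENNReal.ofReal (G.scale j) ^ (α - ((d : ℝ) + 2)) *
        {z | G.cell j z - G.cell j w ∈ box d 1}.indicator (1 : SpaceTime d → ℝ≥0∞) z := fun j =>
      (measurable_one.indicator (hm j w)).const_mul _
    rw [lintegral_add_left ((Measurable.tsum hm1).const_mul _),
      lintegral_const_mul _ (Measurable.tsum hm1), lintegral_tsum fun j => (hm1 j).aemeasurable]
    congr 1
    · congr 2
      ext j
      rw [lintegral_const_mul _ (measurable_one.indicator (hm j w)),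
        lintegral_indicator_one (hm j w), Grid.nbhdMass]
    · rw [G.lintegral_cell 0 μ fun κ => b (κ - G.cell 0 w), ← (Equiv.addLeft (G.cell 0 w)).tsum_eq]
      simp
  have hfar : ∫⁻ w, (∑' v, b v * μ (G.cell 0 ⁻¹' {G.cell 0 w + v})) ^ p ≤
      (∑' v, b v) ^ p * G.wolffEnergy α p μ := by
    rw [G.lintegral_cell 0 volume fun κ => (∑' v, b v * μ (G.cell 0 ⁻¹' {κ + v})) ^ p]
    simp_rw [G.volume_cell]
    rw [ENNReal.tsum_mul_right]
    calc _ ≤ (∑' v, b v) ^ p * (∑' κ, μ (G.cell 0 ⁻¹' {κ}) ^ p) *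
          ENNReal.ofReal (G.scale 0) ^ ((α - (d + 2)) * p + (d + 2)) := by
          refine mul_le_mul' ?_ ?_
          · exact tsum_conv_rpow_le hp b fun κ => μ (G.cell 0 ⁻¹' {κ})
          -- The volume exponent exceeds the Wolff exponent because `α < n`, and the base is below
          -- one.
          · refine ENNReal.rpow_le_rpow_of_exponent_ge ?_ ?_
            · exact ENNReal.ofReal_le_one.2 (G.scale_lt_one 0).le
            · nlinarith
      _ ≤ _ := by
          rw [mul_assoc, mul_comm (∑' κ, _)]
          gcongr
          exact ENNReal.le_tsum (f := fun j => ENNReal.ofReal (G.scale j) ^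
            ((α - (d + 2)) * p + (d + 2)) * ∑' κ, μ (G.cell j ⁻¹' {κ}) ^ p) 0
  calc _ ≤ ∫⁻ w, 2 ^ (p - 1) * ((K : ℝ≥0∞) ^ p *
        (∑' j, ENNReal.ofReal (G.scale j) ^ (α - ((d : ℝ) + 2)) *
          G.nbhdMass μ 1 j (G.cell j w)) ^ p +
        (∑' v, b v * μ (G.cell 0 ⁻¹' {G.cell 0 w + v})) ^ p) := by
        refine lintegral_mono fun w => ?_
        rw [← ENNReal.mul_rpow_of_nonneg _ _ hp0.le]
        exact (ENNReal.rpow_le_rpow (hpot w) hp0.le).trans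
          (ENNReal.rpow_add_le_mul_rpow_add_rpow _ _ hp.le)
    _ = 2 ^ (p - 1) * ((K : ℝ≥0∞) ^ p *
        (∫⁻ w, (∑' j, ENNReal.ofReal (G.scale j) ^ (α - ((d : ℝ) + 2)) *
          G.nbhdMass μ 1 j (G.cell j w)) ^ p) +
        ∫⁻ w, (∑' v, b v * μ (G.cell 0 ⁻¹' {G.cell 0 w + v})) ^ p) := by
        have h1 := (hmn.pow_const p).const_mul ((K : ℝ≥0∞) ^ p)
        rw [lintegral_const_mul' _ _ (ENNReal.rpow_ne_top_of_nonneg (by linarith) (by simp)),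
          lintegral_add_left h1, lintegral_const_mul _ (hmn.pow_const p)]
    _ ≤ 2 ^ (p - 1) * ((K : ℝ≥0∞) ^ p * (C * G.wolffEnergy α p μ) +
        (∑' v, b v) ^ p * G.wolffEnergy α p μ) := by
        gcongr
        exact hC G μ
    _ = _ := by rw [hD]; ring

/-- The translation depends on the generation. Passing from the `p`-th power of the sum to the sum
of `p`-th powers separates the generations, so each can be translated back. -/
theorem exists_wolffEnergy_le (d : ℕ) {α p : ℝ} (hα : 0 < α) (hαn : α < (d : ℝ) + 2)
    (hp : 1 < p) :
    ∃ C : ℝ≥0, ∀ (G : Grid d) (μ : Measure (SpaceTime d)),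
      G.wolffEnergy α p μ ≤ C * ∫⁻ w, backwardBesselPotential α μ w ^ p := by
  obtain ⟨c, hc, hker⟩ := exists_tsum_le_besselKernel d hα hαn
  have hp0 : 0 < p := by linarith
  refine ⟨(c ^ p)⁻¹, fun G μ => ?_⟩
  have hc' : (c : ℝ≥0∞) ≠ 0 := by simpa using hc
  rw [ENNReal.coe_inv (by simpa [hp0.ne'] using hc), ENNReal.coe_rpow_of_nonneg _ hp0.le,
    ← ENNReal.div_eq_inv_mul, ENNReal.le_div_iff_mul_le
      (Or.inl (by simp [hp0, hc, hp0.not_gt])) (Or.inl (ENNReal.rpow_ne_top_of_nonneg hp0.le (by simp)))]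
  have hm : ∀ (j : ℕ) (w : SpaceTime d),
      MeasurableSet {z | G.cell j z = G.cell j (G.shift j w)} := fun j w =>
    G.measurableSet_cell j {G.cell j (G.shift j w)}
  have hpot : ∀ w, c * (∑' j, ENNReal.ofReal (G.scale j) ^ (α - ((d : ℝ) + 2)) *
        μ (G.cell j ⁻¹' {G.cell j (G.shift j w)})) ≤ backwardBesselPotential α μ w := by
    intro w
    refine le_trans (le_of_eq ?_) (lintegral_mono fun z => hker G z w)
    have hm1 : ∀ j, Measurable fun z => ENNReal.ofReal (G.scale j) ^ (α - ((d : ℝ) + 2)) *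
        {z | G.cell j z = G.cell j (G.shift j w)}.indicator (1 : SpaceTime d → ℝ≥0∞) z := fun j =>
      (measurable_one.indicator (hm j w)).const_mul _
    rw [lintegral_const_mul _ (Measurable.tsum hm1), lintegral_tsum fun j => (hm1 j).aemeasurable]
    congr 2
    ext j
    rw [lintegral_const_mul _ (measurable_one.indicator (hm j w)), lintegral_indicator_one (hm j w)]
    rfl
  have hms : ∀ j, Measurable fun w => ENNReal.ofReal (G.scale j) ^ (α - ((d : ℝ) + 2)) *
      μ (G.cell j ⁻¹' {G.cell j (G.shift j w)}) := fun j =>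
    ((G.measurable_measure_cell j μ).comp (measurable_id.add_const _)).const_mul _
  calc _ = (∑' j, ∫⁻ w, (ENNReal.ofReal (G.scale j) ^ (α - ((d : ℝ) + 2)) *
        μ (G.cell j ⁻¹' {G.cell j (G.shift j w)})) ^ p) * (c : ℝ≥0∞) ^ p := by
        rw [Grid.wolffEnergy]
        congr 2
        ext j
        rw [← G.lintegral_scale_mul_measure_cell j hp0.le α μ, ← G.lintegral_comp_shift j]
    _ = (∫⁻ w, ∑' j, (ENNReal.ofReal (G.scale j) ^ (α - ((d : ℝ) + 2)) *
        μ (G.cell j ⁻¹' {G.cell j (G.shift j w)})) ^ p) * (c : ℝ≥0∞) ^ p := by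
        rw [lintegral_tsum fun j => ((hms j).pow_const p).aemeasurable]
    _ = ∫⁻ w, (c : ℝ≥0∞) ^ p * ∑' j, (ENNReal.ofReal (G.scale j) ^ (α - ((d : ℝ) + 2)) *
        μ (G.cell j ⁻¹' {G.cell j (G.shift j w)})) ^ p := by
        rw [lintegral_const_mul' _ _ (ENNReal.rpow_ne_top_of_nonneg hp0.le (by simp)), mul_comm]
    _ ≤ _ := by
        refine lintegral_mono fun w => ?_
        refine le_trans ?_ (ENNReal.rpow_le_rpow (hpot w) hp0.le)
        rw [ENNReal.mul_rpow_of_nonneg _ _ hp0.le]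
        gcongr
        exact tsum_rpow_le_rpow_tsum hp _

/-! ### Capacities -/

theorem lintegral_lintegral_mul_le {X Y : Type*} [MeasurableSpace X] [MeasurableSpace Y]
    (μ : Measure X) [SFinite μ] (ν : Measure Y) [SFinite ν] {q p : ℝ} (hqp : q.HolderConjugate p)
    {k : X → Y → ℝ≥0∞} (hk : Measurable (Function.uncurry k)) {g : Y → ℝ≥0∞}
    (hg : AEMeasurable g ν) :
    ∫⁻ z, (∫⁻ w, k z w * g w ∂ν) ∂μ ≤
      (∫⁻ w, g w ^ q ∂ν) ^ (1 / q) * (∫⁻ w, (∫⁻ z, k z w ∂μ) ^ p ∂ν) ^ (1 / p) := by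
  have hpot : Measurable fun w => ∫⁻ z, k z w ∂μ := hk.lintegral_prod_left
  have hgs : AEMeasurable (fun x : X × Y => g x.2) (μ.prod ν) := hg.comp_snd
  calc _ = ∫⁻ w, (∫⁻ z, k z w * g w ∂μ) ∂ν :=
        lintegral_lintegral_swap (hk.aemeasurable.mul hgs)
    _ = ∫⁻ w, g w * (∫⁻ z, k z w ∂μ) ∂ν := by
        refine lintegral_congr fun w => ?_
        have hm : Measurable fun z => k z w := hk.comp measurable_prodMk_right
        rw [lintegral_mul_const _ hm, mul_comm]
    _ ≤ _ := ENNReal.lintegral_mul_le_Lp_mul_Lq ν hqp hg hpot.aemeasurable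

theorem measurable_uncurry_besselKernel (d : ℕ) (α : ℝ) :
    Measurable (Function.uncurry fun z w : SpaceTime d =>
      ENNReal.ofReal (besselKernel α (z - w))) :=
  ((measurable_besselKernel d α).comp (measurable_fst.sub measurable_snd)).ennreal_ofReal

/-- Weak duality: integrate the admissibility condition over `K`, move the kernel onto `μ` by
Tonelli, and apply Hölder. -/
theorem measure_univ_le_of_bessel {d : ℕ} {α q : ℝ} (hq : 1 < q)
    {K : Set (SpaceTime d)} (hK : IsCompact K) {μ : Measure (SpaceTime d)} [SFinite μ]
    (hμK : μ Kᶜ = 0) {f : SpaceTime d → ℝ} (hfm : AEStronglyMeasurable f volume)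
    (hf : ∀ w, 0 ≤ f w)
    (hfK : ∀ z ∈ K, 1 ≤ ∫⁻ w, ENNReal.ofReal (besselKernel α (z - w) * f w)) :
    μ univ ≤ (∫⁻ w, ENNReal.ofReal (f w) ^ q) ^ (1 / q) *
      besselEnergy α q μ ^ (1 / conjExp q) := by
  have hpq : q.HolderConjugate (conjExp q) := Real.HolderConjugate.conjExponent hq
  calc μ univ ≤ μ K + μ Kᶜ := by rw [← union_compl_self K]; exact measure_union_le _ _
    _ = ∫⁻ _z in K, 1 ∂μ := by simp [hμK]
    _ ≤ ∫⁻ z in K, (∫⁻ w, ENNReal.ofReal (besselKernel α (z - w)) * ENNReal.ofReal (f w)) ∂μ := by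
        refine setLIntegral_mono_ae' hK.measurableSet (Filter.Eventually.of_forall fun z hz => ?_)
        refine (hfK z hz).trans_eq (lintegral_congr fun w => ?_)
        rw [ENNReal.ofReal_mul' (hf w)]
    _ ≤ ∫⁻ z, (∫⁻ w, ENNReal.ofReal (besselKernel α (z - w)) * ENNReal.ofReal (f w)) ∂μ :=
        setLIntegral_le_lintegral _ _
    _ ≤ _ := lintegral_lintegral_mul_le μ volume hpq (measurable_uncurry_besselKernel d α)
        hfm.aemeasurable.ennreal_ofReal

/-- The Euler–Lagrange inequality for a convex homogeneous energy on a simplex. -/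
theorem exists_stdSimplex_energy_le {ι τ : Type*} [Fintype ι] [Nonempty ι] (T : Finset τ)
    (c : τ → ℝ) {A : τ → ι → ℝ} (hA : ∀ x i, 0 ≤ A x i) {p : ℝ}
    (hp : 1 < p) :
    ∃ m ∈ stdSimplex ℝ ι, ∀ i, ∑ x ∈ T, c x * (∑ k, A x k * m k) ^ p ≤
      ∑ x ∈ T, c x * (A x i * (∑ k, A x k * m k) ^ (p - 1)) := by
  classical
  have hcont : Continuous fun m : ι → ℝ => ∑ x ∈ T, c x * (∑ k, A x k * m k) ^ p := by
    refine continuous_finsetSum _ fun x _ => continuous_const.mul ?_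
    refine Continuous.rpow_const (by fun_prop) fun m => Or.inr (by linarith)
  obtain ⟨m, hm, hmin⟩ := (isCompact_stdSimplex ℝ ι).exists_isMinOn
    ⟨_, single_mem_stdSimplex ℝ (Classical.arbitrary ι)⟩ hcont.continuousOn
  refine ⟨m, hm, fun i => ?_⟩
  set y : τ → ℝ := fun x => ∑ k, A x k * m k with hy
  have hy0 : ∀ x, 0 ≤ y x := fun x => Finset.sum_nonneg fun k _ => mul_nonneg (hA x k) (hm.1 k)
  -- Derivative of the energy along the segment from the minimiser to the `i`-th vertex; minimality
  -- makes it nonnegative, and homogeneity turns that into the claim.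
  have hderiv : HasDerivAt (fun s : ℝ => ∑ x ∈ T, c x * (y x + s * (A x i - y x)) ^ p)
      (∑ x ∈ T, c x * ((A x i - y x) * p * y x ^ (p - 1))) 0 := by
    refine HasDerivAt.fun_sum fun x _ => HasDerivAt.const_mul _ ?_
    have h1 : HasDerivAt (fun s : ℝ => y x + s * (A x i - y x)) (A x i - y x) 0 := by
      simpa using ((hasDerivAt_id (0 : ℝ)).mul_const (A x i - y x)).const_add (y x)
    simpa using h1.rpow_const (p := p) (Or.inr hp.le)
  have hnonneg : 0 ≤ ∑ x ∈ T, c x * ((A x i - y x) * p * y x ^ (p - 1)) := by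
    refine ge_of_tendsto hderiv.tendsto_slope_zero_right ?_
    filter_upwards [Ioc_mem_nhdsGT (zero_lt_one' ℝ)] with s hs
    have hs0 : 0 < s := hs.1
    have hmem : (1 - s) • m + s • (Pi.single i 1 : ι → ℝ) ∈ stdSimplex ℝ ι :=
      convex_stdSimplex ℝ ι hm (single_mem_stdSimplex ℝ i) (by linarith [hs.2]) hs0.le (by ring)
    have hle := hmin hmem
    have hlin : ∀ x, ∑ k, A x k * ((1 - s) • m + s • (Pi.single i 1 : ι → ℝ)) k =
        y x + s * (A x i - y x) := by
      intro x
      have h2 : ∑ k, A x k * (Pi.single i 1 : ι → ℝ) k = A x i := by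
        simp [Pi.single_apply]
      calc _ = (1 - s) * y x + s * ∑ k, A x k * (Pi.single i 1 : ι → ℝ) k := by
            rw [hy, Finset.mul_sum, Finset.mul_sum, ← Finset.sum_add_distrib]
            refine Finset.sum_congr rfl fun k _ => ?_
            simp only [Pi.add_apply, Pi.smul_apply, smul_eq_mul]
            ring
        _ = _ := by rw [h2]; ring
    simp only [mem_ofPred_eq, hlin] at hle
    simp only [zero_add, zero_mul, add_zero, smul_eq_mul]
    exact mul_nonneg (inv_nonneg.2 hs0.le) (sub_nonneg.2 hle)
  have hpow : ∀ x, y x ^ p = y x * y x ^ (p - 1) := by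
    intro x
    rcases (hy0 x).eq_or_lt with h | h
    · rw [← h, Real.zero_rpow (by linarith), zero_mul]
    · rw [Real.rpow_sub_one h.ne']; field_simp
  have hsplit : ∑ x ∈ T, c x * ((A x i - y x) * p * y x ^ (p - 1)) =
      p * (∑ x ∈ T, c x * (A x i * y x ^ (p - 1)) - ∑ x ∈ T, c x * y x ^ p) := by
    rw [← Finset.sum_sub_distrib, Finset.mul_sum]
    refine Finset.sum_congr rfl fun x _ => ?_
    rw [hpow]; ring
  rw [hsplit] at hnonneg
  have := nonneg_of_mul_nonneg_right hnonneg (by linarith)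
  linarith

/-! ### Extremal measures for truncated Wolff energies -/

namespace Grid

variable {d : ℕ} (G : Grid d)

theorem finite_image_cell (j : ℕ) {K : Set (SpaceTime d)} (hK : IsCompact K) :
    (G.cell j '' K).Finite := by
  rcases K.eq_empty_or_nonempty with rfl | ⟨z₀, hz₀⟩
  · simp
  have hl := G.scale_pos j
  obtain ⟨m, hm⟩ := exists_nat_ge
    (max (Metric.diam K / G.scale j + 1) (Metric.diam K / G.scale j ^ 2 + 1))
  refine ((box d m).finite_toSet.image fun v => v + G.cell j z₀).subset ?_
  rintro _ ⟨z, hz, rfl⟩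
  have hdist : ‖z - z₀‖ ≤ Metric.diam K := by
    rw [← dist_eq_norm]; exact Metric.dist_le_diam_of_mem hK.isBounded hz hz₀
  refine ⟨G.cell j z - G.cell j z₀, ?_, by simp⟩
  rw [Finset.mem_coe, mem_box]
  constructor
  · intro i
    have h1 := G.cell_sub_fst_le j z z₀ i
    have h2 : |z.1 i - z₀.1 i| ≤ Metric.diam K :=
      (PiLp.norm_apply_le (z - z₀).1 i).trans ((norm_fst_le (z - z₀)).trans hdist)
    have h3 : |(((G.cell j z - G.cell j z₀).1 i : ℤ) : ℝ)| ≤ m :=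
      h1.trans (le_trans (by gcongr) ((le_max_left _ _).trans hm))
    exact_mod_cast h3
  · have h1 := G.cell_sub_snd_le j z z₀
    have h2 : |z.2 - z₀.2| ≤ Metric.diam K := (norm_snd_le (z - z₀)).trans hdist
    have h3 : |(((G.cell j z - G.cell j z₀).2 : ℤ) : ℝ)| ≤ m :=
      h1.trans (le_trans (by gcongr) ((le_max_right _ _).trans hm))
    exact_mod_cast h3

theorem cell_eq_of_le {i j : ℕ} (hij : i ≤ j) {z w : SpaceTime d} (h : G.cell j z = G.cell j w) :
    G.cell i z = G.cell i w := by
  obtain ⟨k, rfl⟩ := Nat.exists_eq_add_of_le hij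
  rw [G.cell_add i k z, G.cell_add i k w, h]

/-- A probability measure on a compact set whose dyadic Wolff potential, truncated at generation
`N`, is everywhere on the set at least the truncated Wolff energy. -/
theorem exists_extremal_measure {K : Set (SpaceTime d)} (hK : IsCompact K) (hne : K.Nonempty)
    {c : ℕ → ℝ} (hc : ∀ j, 0 ≤ c j) {p : ℝ} (hp : 1 < p) (N : ℕ) :
    ∃ ν : ProbabilityMeasure K, ∀ z ∈ K,
      ∑ j ∈ Finset.range (N + 1), ENNReal.ofReal (c j) *
          ∑' κ, ((ν : Measure K).map Subtype.val) (G.cell j ⁻¹' {κ}) ^ p ≤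
        ∑ j ∈ Finset.range (N + 1), ENNReal.ofReal (c j) *
          ((ν : Measure K).map Subtype.val) (G.cell j ⁻¹' {G.cell j z}) ^ (p - 1) := by
  classical
  have hS := G.finite_image_cell N hK
  -- Up to generation `N` a measure on `K` is seen only through its masses on the finitely many
  -- cells of generation `N` meeting `K`, so point masses at one representative per cell suffice.
  let ι := ↥(G.cell N '' K)
  have : Fintype ι := hS.fintype
  have : Nonempty ι := (hne.image _).to_subtype
  choose rep hrepK hrep using fun i : ι => i.2
  -- Contains every label that can carry mass in generations up to `N`, which makes the sums over
  -- labels finite.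
  let W : Finset (Index d) := (Finset.range (N + 1) ×ˢ (Finset.univ : Finset ι)).image
    fun x => G.cell x.1 (rep x.2)
  let A : ℕ × Index d → ι → ℝ := fun x i => if G.cell x.1 (rep i) = x.2 then 1 else 0
  have hA : ∀ x i, 0 ≤ A x i := fun x i => by simp only [A]; split_ifs <;> norm_num
  obtain ⟨m, hm, hle⟩ := exists_stdSimplex_energy_le (Finset.range (N + 1) ×ˢ W)
    (fun x => c x.1) hA hp
  let y : ℕ × Index d → ℝ := fun x => ∑ k, A x k * m k
  have hy0 : ∀ x, 0 ≤ y x := fun x => Finset.sum_nonneg fun k _ => mul_nonneg (hA x k) (hm.1 k)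
  let ν : Measure K := ∑ i, ENNReal.ofReal (m i) • Measure.dirac ⟨rep i, hrepK i⟩
  have hν : IsProbabilityMeasure ν := ⟨by
    simp only [ν, Measure.finsetSum_apply, Measure.smul_apply, measure_univ, smul_eq_mul, mul_one]
    rw [← ENNReal.ofReal_sum_of_nonneg fun i _ => hm.1 i, hm.2, ENNReal.ofReal_one]⟩
  have hνcell : ∀ j κ, (ν.map Subtype.val) (G.cell j ⁻¹' {κ}) = ENNReal.ofReal (y (j, κ)) := by
    intro j κ
    have hms : MeasurableSet (Subtype.val ⁻¹' (G.cell j ⁻¹' {κ}) : Set K) :=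
      measurable_subtype_coe (G.measurableSet_cell j _)
    rw [Measure.map_apply measurable_subtype_coe (G.measurableSet_cell j _)]
    simp only [ν, Measure.finsetSum_apply, Measure.smul_apply, smul_eq_mul]
    rw [ENNReal.ofReal_sum_of_nonneg fun k _ => mul_nonneg (hA _ k) (hm.1 k)]
    refine Finset.sum_congr rfl fun i _ => ?_
    rw [Measure.dirac_apply' _ hms, mul_comm]
    by_cases h : G.cell j (rep i) = κ <;> simp [A, indicator, h]
  refine ⟨⟨ν, hν⟩, fun z hz => ?_⟩
  simp only [ProbabilityMeasure.coe_mk, hνcell]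
  -- The representative of the finest cell of `z` has the same ancestors as `z`, so the inequality
  -- at the vertex `i` is the one at `z`.
  let i : ι := ⟨G.cell N z, z, hz, rfl⟩
  have hi : ∀ j ∈ Finset.range (N + 1), G.cell j (rep i) = G.cell j z := fun j hj =>
    G.cell_eq_of_le (Nat.lt_succ_iff.1 (Finset.mem_range.1 hj)) (hrep i)
  have hlhs : ∀ j ∈ Finset.range (N + 1), ∑' κ, ENNReal.ofReal (y (j, κ)) ^ p =
      ENNReal.ofReal (∑ κ ∈ W, y (j, κ) ^ p) := by
    intro j hj
    rw [tsum_eq_sum (s := W), ENNReal.ofReal_sum_of_nonneg fun κ _ => Real.rpow_nonneg (hy0 _) _]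
    · refine Finset.sum_congr rfl fun κ _ => ?_
      rw [ENNReal.ofReal_rpow_of_nonneg (hy0 _) (by linarith)]
    · intro κ hκ
      have : y (j, κ) = 0 := by
        refine Finset.sum_eq_zero fun k _ => ?_
        have : G.cell j (rep k) ≠ κ := fun h =>
          hκ (Finset.mem_image.2 ⟨(j, k), Finset.mem_product.2 ⟨hj, Finset.mem_univ _⟩, h⟩)
        simp [A, this]
      rw [this, ENNReal.ofReal_zero, ENNReal.zero_rpow_of_pos (by linarith)]
  have hreal := ENNReal.ofReal_le_ofReal (hle i)
  rw [Finset.sum_product, Finset.sum_product] at hreal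
  refine le_trans (le_of_eq ?_) (hreal.trans (le_of_eq ?_))
  · rw [ENNReal.ofReal_sum_of_nonneg fun j _ => Finset.sum_nonneg fun κ _ =>
      mul_nonneg (hc _) (Real.rpow_nonneg (hy0 _) _)]
    refine Finset.sum_congr rfl fun j hj => ?_
    rw [hlhs j hj, ← ENNReal.ofReal_mul (hc j), Finset.mul_sum]
  · rw [ENNReal.ofReal_sum_of_nonneg fun j _ => Finset.sum_nonneg fun κ _ =>
      mul_nonneg (hc _) (mul_nonneg (hA _ _) (Real.rpow_nonneg (hy0 _) _))]
    refine Finset.sum_congr rfl fun j hj => ?_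
    rw [ENNReal.ofReal_rpow_of_nonneg (hy0 _) (by linarith), ← ENNReal.ofReal_mul (hc j),
      Finset.sum_eq_single (G.cell j z)]
    · simp [A, y, hi j hj]
    · intro κ _ hκ
      simp [A, hi j hj, hκ.symm]
    · intro hW
      exact (hW (Finset.mem_image.2 ⟨(j, i), Finset.mem_product.2 ⟨hj, Finset.mem_univ _⟩,
        hi j hj⟩)).elim

end Grid
-- Test functions for the Bessel capacity
theorem memLp_ofReal_of_lintegral_ne_top {X : Type*} [MeasurableSpace X] {μ : Measure X}
    {f : X → ℝ} {q : ℝ} (hq : 0 < q) (hfm : Measurable f) (hf : ∀ w, 0 ≤ f w)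
    (h : ∫⁻ w, ENNReal.ofReal (f w) ^ q ∂μ ≠ ⊤) : MemLp f (ENNReal.ofReal q) μ := by
  refine ⟨hfm.aestronglyMeasurable, ?_⟩
  rw [eLpNorm_lt_top_iff_lintegral_rpow_enorm_lt_top (by simpa using hq) ENNReal.ofReal_ne_top,
    ENNReal.toReal_ofReal hq.le]
  simp_rw [Real.enorm_of_nonneg (hf _)]
  exact h.lt_top

theorem besselCapacity_le {d : ℕ} {α q : ℝ} {A : Set (SpaceTime d)} {f : SpaceTime d → ℝ}
    (hfp : MemLp f (ENNReal.ofReal q) volume) (hf : ∀ w, 0 ≤ f w)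
    (hfA : ∀ z ∈ A, 1 ≤ ∫⁻ w, ENNReal.ofReal (besselKernel α (z - w) * f w)) :
    besselCapacity α q A ≤ ∫⁻ w, ENNReal.ofReal (f w) ^ q :=
  iInf_le_of_le f (iInf_le_of_le hfp (iInf_le_of_le hf (iInf_le_of_le hfA le_rfl)))

theorem conjExp_div {q : ℝ} (hq : 1 < q) : conjExp q / q = conjExp q - 1 := by
  have : q - 1 ≠ 0 := by linarith
  rw [conjExp]; field_simp; ring

/-- The Bessel capacity of a set is controlled by the truncated Wolff energy of any measure whose
truncated dyadic Wolff potential dominates that energy on the set. -/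
theorem exists_besselCapacity_le_of_potential (d : ℕ) {α q : ℝ} (hα : 0 < α)
    (hαn : α < (d : ℝ) + 2) (hq : 1 < q) :
    ∃ c : ℝ≥0, c ≠ 0 ∧ ∀ (G : Grid d) (K : Set (SpaceTime d)) (μ : Measure (SpaceTime d))
      [IsFiniteMeasure μ] (N : ℕ) (E : ℝ≥0∞), E ≠ 0 → E ≠ ⊤ →
      E = ∑ j ∈ Finset.range (N + 1),
        ENNReal.ofReal (G.scale j) ^ ((α - (d + 2)) * conjExp q + (d + 2)) *
          ∑' κ, μ (G.cell j ⁻¹' {κ}) ^ conjExp q →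
      (∀ z ∈ K, E ≤ ∑ j ∈ Finset.range (N + 1),
        ENNReal.ofReal (G.scale j) ^ ((α - (d + 2)) * conjExp q + (d + 2)) *
          μ (G.cell j ⁻¹' {G.cell j z}) ^ (conjExp q - 1)) →
      besselCapacity α q K ≤ ((c * E) ^ q)⁻¹ * E := by
  obtain ⟨c, hc, hker⟩ := exists_tsum_le_besselKernel d hα hαn
  have hq0 : 0 < q := by linarith
  have hp := one_lt_conjExp hq
  set p := conjExp q with hpdef
  have hp0 : 0 < p := by linarith
  refine ⟨c, hc, fun G K μ _ N E hE0 hEt hE hK => ?_⟩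
  have hc0 : (c : ℝ≥0∞) ≠ 0 := by simpa using hc
  have hcE0 : c * E ≠ 0 := mul_ne_zero hc0 hE0
  have hcEt : c * E ≠ ⊤ := ENNReal.mul_ne_top ENNReal.coe_ne_top hEt
  set l : ℕ → ℝ≥0∞ := fun j => ENNReal.ofReal (G.scale j) with hl
  have hl0 : ∀ j, l j ≠ 0 := G.ofReal_scale_ne_zero
  have hlt : ∀ j, l j ≠ ⊤ := fun j => ENNReal.ofReal_ne_top
  set u : ℕ → SpaceTime d → ℝ≥0∞ := fun j w => l j ^ (α - ((d : ℝ) + 2)) *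
    μ (G.cell j ⁻¹' {G.cell j (G.shift j w)}) with hu
  have hum : ∀ j, Measurable (u j) := fun j =>
    ((G.measurable_measure_cell j μ).comp (measurable_id.add_const _)).const_mul _
  have hut : ∀ j w, u j w ≠ ⊤ := fun j w =>
    ENNReal.mul_ne_top (ENNReal.rpow_ne_top_of_ne_zero (hl0 j) (hlt j)) (measure_ne_top _ _)
  -- Since `p / q = p - 1`, this function dominates every `u j ^ (p - 1)` with `j ≤ N`, while the
  -- integral of its `q`-th power is exactly the truncated energy.
  set F : SpaceTime d → ℝ≥0∞ := fun w => (∑ j ∈ Finset.range (N + 1), u j w ^ p) ^ q⁻¹ with hF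
  have hFm : Measurable F :=
    (Finset.measurable_fun_sum _ fun j _ => (hum j).pow_const p).pow_const _
  have hFt : ∀ w, F w ≠ ⊤ := fun w => ENNReal.rpow_ne_top_of_nonneg (by positivity)
    (ENNReal.sum_ne_top.2 fun j _ => ENNReal.rpow_ne_top_of_nonneg hp0.le (hut j w))
  have hF_int : ∫⁻ w, F w ^ q = E := by
    simp_rw [hF, ENNReal.rpow_inv_rpow hq0.ne']
    rw [lintegral_finsetSum _ fun j _ => (hum j).pow_const p, hE]
    refine Finset.sum_congr rfl fun j _ => ?_
    rw [← G.lintegral_scale_mul_measure_cell j hp0.le α μ]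
    exact G.lintegral_comp_shift j fun w =>
      (l j ^ (α - ((d : ℝ) + 2)) * μ (G.cell j ⁻¹' {G.cell j w})) ^ p
  have hFu : ∀ j ∈ Finset.range (N + 1), ∀ w, u j w ^ (p - 1) ≤ F w := by
    intro j hj w
    rw [← conjExp_div hq, div_eq_mul_inv, ENNReal.rpow_mul]
    exact ENNReal.rpow_le_rpow (Finset.single_le_sum (f := fun j => u j w ^ p)
      (fun _ _ => zero_le) hj) (by positivity)
  set f : SpaceTime d → ℝ := fun w => (F w * (c * E)⁻¹).toReal with hf
  have hfm : Measurable f := (hFm.mul_const _).ennreal_toReal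
  have hf0 : ∀ w, 0 ≤ f w := fun w => ENNReal.toReal_nonneg
  have hfF : ∀ w, ENNReal.ofReal (f w) = F w * (c * E)⁻¹ := fun w =>
    ENNReal.ofReal_toReal (ENNReal.mul_ne_top (hFt w) (ENNReal.inv_ne_top.2 hcE0))
  have hf_int : ∫⁻ w, ENNReal.ofReal (f w) ^ q = ((c * E) ^ q)⁻¹ * E := by
    simp_rw [hfF, fun w => ENNReal.mul_rpow_of_nonneg (F w) (c * E)⁻¹ hq0.le]
    rw [lintegral_mul_const _ (hFm.pow_const q), hF_int, ENNReal.inv_rpow, mul_comm]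
  have hf_int_ne : ((c * E) ^ q)⁻¹ * E ≠ ⊤ := by
    refine ENNReal.mul_ne_top (ENNReal.inv_ne_top.2 ?_) hEt
    simp [ENNReal.rpow_eq_zero_iff, hcE0, hcEt]
  rw [← hf_int]
  refine besselCapacity_le (memLp_ofReal_of_lintegral_ne_top hq0 hfm hf0 (by rwa [hf_int])) hf0
    fun z hz => ?_
  set I : ℕ → SpaceTime d → ℝ≥0∞ := fun j w => (G.cell j ⁻¹' {G.cell j z}).indicator 1
    (G.shift j w) with hI
  have hIm : ∀ j, Measurable (I j) := fun j =>
    (measurable_one.indicator (G.measurableSet_cell j _)).comp (measurable_id.add_const _)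
  have hI_int : ∀ j, ∫⁻ w, I j w = l j ^ ((d : ℝ) + 2) := by
    intro j
    rw [hI, G.lintegral_comp_shift j, lintegral_indicator_one (G.measurableSet_cell j _),
      G.volume_cell]
  set V : ℕ → ℝ≥0∞ := fun j => (l j ^ (α - ((d : ℝ) + 2)) *
    μ (G.cell j ⁻¹' {G.cell j z})) ^ (p - 1) with hV
  -- In each generation the kernel is kept only where `w`, translated, lies in the cell of `z`;
  -- there `F` is at least the constant `V j`, so integration reproduces the Wolff potential at `z`.
  have hpt : ∀ w, ∑ j ∈ Finset.range (N + 1), c * (l j ^ (α - ((d : ℝ) + 2)) * V j) *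
      (c * E)⁻¹ * I j w ≤ ENNReal.ofReal (besselKernel α (z - w) * f w) := by
    intro w
    rw [ENNReal.ofReal_mul (besselKernel_nonneg hα _), hfF]
    refine le_trans ?_ (mul_le_mul_left (hker G z w) _)
    calc _ ≤ ∑ j ∈ Finset.range (N + 1), c * (l j ^ (α - ((d : ℝ) + 2)) *
          {z | G.cell j z = G.cell j (G.shift j w)}.indicator 1 z) * (F w * (c * E)⁻¹) := by
          refine Finset.sum_le_sum fun j hj => ?_
          by_cases h : G.cell j z = G.cell j (G.shift j w)
          · have h1 : I j w = 1 := by simp [hI, h]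
            have h2 : V j ≤ F w := by
              refine le_trans (le_of_eq ?_) (hFu j hj w)
              simp only [hV, hu, h]
            have h3 : z ∈ {z | G.cell j z = G.cell j (G.shift j w)} := h
            rw [h1, indicator_of_mem h3, Pi.one_apply, mul_one, mul_one]
            calc _ = c * l j ^ (α - ((d : ℝ) + 2)) * (V j * (c * E)⁻¹) := by ring
              _ ≤ _ := by gcongr
          · have h1 : I j w = 0 := by
              have h2 : G.shift j w ∉ G.cell j ⁻¹' {G.cell j z} := fun h' => h (Eq.symm h')
              simp only [hI, indicator_of_notMem h2]
            rw [h1, mul_zero]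
            exact zero_le
      _ ≤ _ := by
          rw [← Finset.sum_mul, ← Finset.mul_sum]
          gcongr
          exact ENNReal.sum_le_tsum _
  calc (1 : ℝ≥0∞) = c * E * (c * E)⁻¹ := (ENNReal.mul_inv_cancel hcE0 hcEt).symm
    _ ≤ c * (∑ j ∈ Finset.range (N + 1), l j ^ ((α - (d + 2)) * p + (d + 2)) *
          μ (G.cell j ⁻¹' {G.cell j z}) ^ (p - 1)) * (c * E)⁻¹ := by
        gcongr
        exact hK z hz
    _ = ∑ j ∈ Finset.range (N + 1), c * (l j ^ (α - ((d : ℝ) + 2)) * V j) *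
          (c * E)⁻¹ * l j ^ ((d : ℝ) + 2) := by
        rw [Finset.mul_sum, Finset.sum_mul]
        refine Finset.sum_congr rfl fun j _ => ?_
        have h1 : l j ^ ((α - ((d : ℝ) + 2)) * p + ((d : ℝ) + 2)) =
            l j ^ (α - ((d : ℝ) + 2)) * l j ^ ((α - ((d : ℝ) + 2)) * (p - 1)) *
              l j ^ ((d : ℝ) + 2) := by
          rw [← ENNReal.rpow_add _ _ (hl0 j) (hlt j), ← ENNReal.rpow_add _ _ (hl0 j) (hlt j)]
          congr 1; ring
        simp only [hV]
        rw [h1, ENNReal.mul_rpow_of_nonneg _ _ (by linarith), ← ENNReal.rpow_mul]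
        ring
    _ = ∫⁻ w, ∑ j ∈ Finset.range (N + 1), c * (l j ^ (α - ((d : ℝ) + 2)) * V j) *
          (c * E)⁻¹ * I j w := by
        rw [lintegral_finsetSum _ fun j _ => (hIm j).const_mul _]
        refine Finset.sum_congr rfl fun j _ => ?_
        rw [lintegral_const_mul _ (hIm j), hI_int]
    _ ≤ _ := lintegral_mono hpt

/-! ### Homogeneity and lower semicontinuity of the regularized energy -/

namespace Grid.Fits

variable {d : ℕ} {G : Grid d} {U : Set (SpaceTime d)} {𝒟 : Set (BackwardRect d)}

theorem regEnergy_smul (hG : G.Fits U 𝒟) {η : BackwardRect d → SpaceTime d → ℝ}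
    (hη : ∀ R ∈ 𝒟, IsCutoff R (η R)) (α : ℝ) {q : ℝ} (hq : 1 < q) (s : ℝ≥0∞)
    (μ : Measure (SpaceTime d)) :
    regEnergy α q 𝒟 η (s • μ) = s ^ conjExp q * regEnergy α q 𝒟 η μ := by
  have hp := one_lt_conjExp hq
  rw [hG.regEnergy_eq hη α hq, hG.regEnergy_eq hη α hq, ← ENNReal.tsum_mul_left]
  refine tsum_congr fun j => ?_
  rw [← ENNReal.tsum_mul_left]
  refine tsum_congr fun κ => ?_
  by_cases h : G.rect j κ ∈ 𝒟
  · rw [indicator_of_mem h, indicator_of_mem h, lintegral_smul_measure, smul_eq_mul,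
      ENNReal.mul_rpow_of_nonneg _ _ (by linarith)]
    ring
  · simp [h]

/-- The regularized energy is lower semicontinuous for weak convergence, also along measures whose
energies are only controlled up to increasing generations. -/
theorem regEnergy_le_of_tendsto (hG : G.Fits U 𝒟) {η : BackwardRect d → SpaceTime d → ℝ}
    (hη : ∀ R ∈ 𝒟, IsCutoff R (η R)) (α : ℝ) {q : ℝ} (hq : 1 < q) {K : Set (SpaceTime d)}
    [CompactSpace K] {l : Filter ℕ} [l.NeBot] (hl : l ≤ Filter.atTop)
    {ν : ℕ → ProbabilityMeasure K} {ν₀ : ProbabilityMeasure K}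
    (hν : Filter.Tendsto ν l (nhds ν₀)) {B : ℝ≥0∞}
    (hB : ∀ N, ∑ j ∈ Finset.range (N + 1),
        ENNReal.ofReal (G.scale j) ^ ((α - (d + 2)) * conjExp q + (d + 2)) *
          ∑' κ, ((ν N : Measure K).map Subtype.val) (G.cell j ⁻¹' {κ}) ^ conjExp q ≤ B) :
    regEnergy α q 𝒟 η ((ν₀ : Measure K).map Subtype.val) ≤
      ((box d 9).card : ℝ≥0∞) ^ conjExp q * B := by
  have hp := one_lt_conjExp hq
  set p := conjExp q
  set term : ProbabilityMeasure K → ℕ × Index d → ℝ≥0∞ := fun ν x =>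
    𝒟.indicator (fun R => ENNReal.ofReal R.side ^ ((α - ((d : ℝ) + 2)) * p + ((d : ℝ) + 2)) *
      (∫⁻ z, ENNReal.ofReal (η R z) ∂((ν : Measure K).map Subtype.val)) ^ p)
      (G.rect x.1 x.2) with hterm
  -- Weak convergence passes to `μ(η_R)` because `η_R` is continuous; masses `μ(R)` of half-open
  -- rectangles need not converge.
  have hlim : ∀ x, Filter.Tendsto (fun N => term (ν N) x) l (nhds (term ν₀ x)) := by
    intro x
    by_cases h : G.rect x.1 x.2 ∈ 𝒟
    · simp only [hterm, indicator_of_mem h]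
      have hcont : Continuous (η (G.rect x.1 x.2)) := (hη _ h).contDiff.continuous
      let φ : BoundedContinuousFunction K ℝ≥0 := BoundedContinuousFunction.mkOfCompact
        ⟨fun z => (η (G.rect x.1 x.2) z).toNNReal,
          (continuous_real_toNNReal.comp hcont).comp continuous_subtype_val⟩
      have h1 := (ProbabilityMeasure.tendsto_iff_forall_lintegral_tendsto.1 hν) φ
      have h2 : ∀ ν' : ProbabilityMeasure K, ∫⁻ z, ENNReal.ofReal (η (G.rect x.1 x.2) z)
          ∂((ν' : Measure K).map Subtype.val) = ∫⁻ z, φ z ∂(ν' : Measure K) := by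
        intro ν'
        rw [lintegral_map hcont.measurable.ennreal_ofReal measurable_subtype_coe]
        rfl
      simp_rw [h2]
      refine ENNReal.Tendsto.const_mul ((ENNReal.continuous_rpow_const.tendsto _).comp h1)
        (Or.inr ?_)
      exact ENNReal.rpow_ne_top_of_ne_zero (G.ofReal_scale_ne_zero _) ENNReal.ofReal_ne_top
    · simp only [hterm, indicator_of_notMem h]
      exact tendsto_const_nhds
  rw [hG.regEnergy_eq hη α hq, ← ENNReal.tsum_prod
    (f := fun j κ => term ν₀ (j, κ)), ENNReal.tsum_eq_iSup_sum]
  refine iSup_le fun T => ?_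
  have hT : Filter.Tendsto (fun N => ∑ x ∈ T, term (ν N) x) l (nhds (∑ x ∈ T, term ν₀ x)) :=
    tendsto_finsetSum _ fun x _ => hlim x
  -- A finite set of terms involves finitely many generations, all covered by the truncated bound
  -- once `N` is large.
  refine le_of_tendsto hT ?_
  filter_upwards [hl (Filter.eventually_ge_atTop (T.sup Prod.fst))] with N hN
  calc ∑ x ∈ T, term (ν N) x
      ≤ ∑ x ∈ Finset.range (N + 1) ×ˢ T.image Prod.snd, term (ν N) x := by
        refine Finset.sum_le_sum_of_subset fun x hx => Finset.mem_product.2 ⟨?_, ?_⟩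
        · exact Finset.mem_range.2 (Nat.lt_succ_of_le ((Finset.le_sup (f := Prod.fst) hx).trans hN))
        · exact Finset.mem_image_of_mem _ hx
    _ ≤ ∑ j ∈ Finset.range (N + 1), ∑' κ, term (ν N) (j, κ) := by
        rw [Finset.sum_product]
        exact Finset.sum_le_sum fun j _ => ENNReal.sum_le_tsum _
    _ ≤ ∑ j ∈ Finset.range (N + 1), ((box d 9).card : ℝ≥0∞) ^ p *
        (ENNReal.ofReal (G.scale j) ^ ((α - (d + 2)) * p + (d + 2)) *
          ∑' κ, ((ν N : Measure K).map Subtype.val) (G.cell j ⁻¹' {κ}) ^ p) :=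
        Finset.sum_le_sum fun j _ => regEnergy_term_le hη α hp j
    _ ≤ _ := by
        rw [← Finset.mul_sum]
        gcongr
        exact hB N

end Grid.Fits

/-! ### Comparison of the two capacities -/

theorem besselCapacity_empty (d : ℕ) (α : ℝ) {q : ℝ} (hq : 0 < q) :
    besselCapacity α q (∅ : Set (SpaceTime d)) = 0 := by
  refine le_antisymm ?_ zero_le
  refine (besselCapacity_le (f := fun _ => 0) (MemLp.zero' ) (fun _ => le_rfl) (by simp)).trans ?_
  simp [hq]

/-- The extremal measures bound the capacity by `c^(-q) E_N^(1-q)`; read backwards, this bounds the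
truncated energies uniformly in `N` when the capacity is positive. Their weak limit, rescaled to
regularized energy at most one, has the mass required. -/
theorem exists_besselCapacity_le_dyadicCapacity (d : ℕ) {α q : ℝ} (hα : 0 < α)
    (hαn : α < (d : ℝ) + 2) (hq : 1 < q) :
    ∃ C : ℝ≥0, ∀ (G : Grid d) (U : Set (SpaceTime d)) (𝒟 : Set (BackwardRect d)),
      G.Fits U 𝒟 → ∀ η : BackwardRect d → SpaceTime d → ℝ, (∀ R ∈ 𝒟, IsCutoff R (η R)) →
      ∀ K : Set (SpaceTime d), IsCompact K →
        besselCapacity α q K ≤ C * dyadicCapacity α q 𝒟 η K := by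
  obtain ⟨c, hc, hcap⟩ := exists_besselCapacity_le_of_potential d hα hαn hq
  have hq0 : 0 < q := by linarith
  have hq1 : 0 < q - 1 := by linarith
  have hp := one_lt_conjExp hq
  have hpq : conjExp q = q / (q - 1) := rfl
  set p := conjExp q with hpdef
  have hp0 : 0 < p := by linarith
  have hc0 : (c : ℝ≥0∞) ≠ 0 := by simpa using hc
  have hcq0 : (c : ℝ≥0∞) ^ q ≠ 0 := by simp [ENNReal.rpow_eq_zero_iff, hc, hq0.not_gt]
  have hcqt : (c : ℝ≥0∞) ^ q ≠ ⊤ := ENNReal.rpow_ne_top_of_nonneg hq0.le ENNReal.coe_ne_top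
  set D : ℝ≥0∞ := ((box d 9).card : ℝ≥0∞) ^ p with hD
  have hcard : (box d 9).card ≠ 0 := Finset.card_ne_zero_of_mem (a := 0) (by simp [mem_box])
  have hD0 : D ≠ 0 := by simp [hD, ENNReal.rpow_eq_zero_iff, hcard, hp0.not_gt]
  have hDt : D ≠ ⊤ := ENNReal.rpow_ne_top_of_nonneg hp0.le (ENNReal.natCast_ne_top _)
  have hCt : (c ^ q : ℝ≥0∞)⁻¹ * D ^ (q - 1) ≠ ⊤ := ENNReal.mul_ne_top
    (ENNReal.inv_ne_top.2 hcq0) (ENNReal.rpow_ne_top_of_nonneg hq1.le hDt)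
  refine ⟨((c ^ q : ℝ≥0∞)⁻¹ * D ^ (q - 1)).toNNReal, fun G U 𝒟 hG η hη K hK => ?_⟩
  rw [ENNReal.coe_toNNReal hCt]
  rcases K.eq_empty_or_nonempty with rfl | hne
  · rw [besselCapacity_empty d α hq0]; exact zero_le
  rcases eq_or_ne (besselCapacity α q K) 0 with h0 | h0
  · rw [h0]; exact zero_le
  have : CompactSpace K := isCompact_iff_compactSpace.1 hK
  have hext := fun N => G.exists_extremal_measure hK hne
    (c := fun j => G.scale j ^ ((α - ((d : ℝ) + 2)) * p + ((d : ℝ) + 2)))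
    (fun j => Real.rpow_nonneg (G.scale_pos j).le _) hp N
  simp only [← ENNReal.ofReal_rpow_of_pos (G.scale_pos _)] at hext
  choose ν hν using hext
  have hprob : ∀ ν' : ProbabilityMeasure K,
      IsProbabilityMeasure ((ν' : Measure K).map Subtype.val) := fun ν' =>
    Measure.isProbabilityMeasure_map measurable_subtype_coe.aemeasurable
  set E : ℕ → ℝ≥0∞ := fun N => ∑ j ∈ Finset.range (N + 1),
    ENNReal.ofReal (G.scale j) ^ ((α - ((d : ℝ) + 2)) * p + ((d : ℝ) + 2)) *
      ∑' κ, ((ν N : Measure K).map Subtype.val) (G.cell j ⁻¹' {κ}) ^ p with hE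
  have hmass : ∀ N j, ∑' κ, ((ν N : Measure K).map Subtype.val) (G.cell j ⁻¹' {κ}) = 1 := by
    intro N j
    have := hprob (ν N)
    have h := G.lintegral_cell j ((ν N : Measure K).map Subtype.val) fun _ => 1
    simpa using h.symm
  have hw0 : ∀ j (e : ℝ), ENNReal.ofReal (G.scale j) ^ e ≠ 0 := fun j e => by
    simp [ENNReal.rpow_eq_zero_iff, (G.scale_pos j).not_ge]
  have hE0 : ∀ N, E N ≠ 0 := by
    intro N h
    have h1 := (Finset.sum_eq_zero_iff.1 h) 0 (by simp)
    have h2 := (mul_eq_zero.1 h1).resolve_left (hw0 _ _)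
    rw [ENNReal.tsum_eq_zero] at h2
    have h3 : ∀ κ, ((ν N : Measure K).map Subtype.val) (G.cell 0 ⁻¹' {κ}) = 0 := fun κ =>
      (ENNReal.rpow_eq_zero_iff_of_pos hp0).1 (h2 κ)
    have h4 := hmass N 0
    simp [h3] at h4
  have hEt : ∀ N, E N ≠ ⊤ := by
    intro N
    refine ENNReal.sum_ne_top.2 fun j _ => ENNReal.mul_ne_top
      (ENNReal.rpow_ne_top_of_ne_zero (G.ofReal_scale_ne_zero j) ENNReal.ofReal_ne_top) ?_
    have := hprob (ν N)
    refine ne_top_of_le_ne_top ENNReal.one_ne_top (le_trans ?_ (hmass N j).le)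
    refine ENNReal.tsum_le_tsum fun κ => ?_
    exact ENNReal.rpow_le_self_of_le_one prob_le_one hp.le
  have hcapN : ∀ N, besselCapacity α q K ≤ ((c * E N) ^ q)⁻¹ * E N := by
    intro N
    have := hprob (ν N)
    exact hcap G K _ N (E N) (hE0 N) (hEt N) rfl (hν N)
  have hcapt : besselCapacity α q K ≠ ⊤ := by
    refine ne_top_of_le_ne_top (ENNReal.mul_ne_top (ENNReal.inv_ne_top.2 ?_) (hEt 0)) (hcapN 0)
    simp [ENNReal.rpow_eq_zero_iff, hc, hE0 0, hq0.not_gt]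
  set X : ℝ≥0∞ := besselCapacity α q K * (c : ℝ≥0∞) ^ q with hX
  have hX0 : X ≠ 0 := mul_ne_zero h0 hcq0
  have hXt : X ≠ ⊤ := ENNReal.mul_ne_top hcapt hcqt
  -- Solves `X * B^(q-1) = 1`, the inequality `cap * c^q * E_N^(q-1) ≤ 1` at equality.
  set B : ℝ≥0∞ := X⁻¹ ^ (q - 1)⁻¹ with hB
  have hEB : ∀ N, E N ≤ B := by
    intro N
    rw [hB, ENNReal.le_rpow_inv_iff hq1, ENNReal.le_inv_iff_mul_le]
    calc E N ^ (q - 1) * X ≤ E N ^ (q - 1) * ((((c : ℝ≥0∞) * E N) ^ q)⁻¹ * E N * c ^ q) := by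
          rw [hX]; gcongr; exact hcapN N
      _ = (E N ^ (q - 1) * E N) * c ^ q * (((c : ℝ≥0∞) * E N) ^ q)⁻¹ := by ring
      _ = 1 := by
          have h1 : E N ^ (q - 1) * E N = E N ^ q := by
            nth_rw 2 [← ENNReal.rpow_one (E N)]
            rw [← ENNReal.rpow_add _ _ (hE0 N) (hEt N), sub_add_cancel]
          rw [h1, mul_comm (E N ^ q), ← ENNReal.mul_rpow_of_nonneg _ _ hq0.le]
          exact ENNReal.mul_inv_cancel
            (by simp [ENNReal.rpow_eq_zero_iff, hc, hE0 N, hq0.not_gt])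
            (ENNReal.rpow_ne_top_of_nonneg hq0.le
              (ENNReal.mul_ne_top ENNReal.coe_ne_top (hEt N)))
  have hB0 : B ≠ 0 := by
    simp [hB, ENNReal.rpow_eq_zero_iff, hXt, hq1.not_gt]
  have hBt : B ≠ ⊤ := ENNReal.rpow_ne_top_of_nonneg (by positivity) (ENNReal.inv_ne_top.2 hX0)
  -- Probability measures on the compact set `K` form a compact space, so a limit along a free
  -- ultrafilter exists without extracting a subsequence.
  set 𝒰 : Ultrafilter ℕ := Filter.hyperfilter ℕ
  have hlim : Filter.Tendsto ν 𝒰 (nhds (𝒰.map ν).lim) := (𝒰.map ν).le_nhds_lim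
  set ν₀ := (𝒰.map ν).lim
  have hreg : regEnergy α q 𝒟 η ((ν₀ : Measure K).map Subtype.val) ≤ D * B :=
    hG.regEnergy_le_of_tendsto hη α hq Nat.hyperfilter_le_atTop hlim hEB
  have hDB0 : D * B ≠ 0 := mul_ne_zero hD0 hB0
  have hDBt : D * B ≠ ⊤ := ENNReal.mul_ne_top hDt hBt
  set s : ℝ≥0∞ := (D * B)⁻¹ ^ p⁻¹ with hs
  have hst : s ≠ ⊤ := ENNReal.rpow_ne_top_of_nonneg (by positivity) (ENNReal.inv_ne_top.2 hDB0)
  have := hprob ν₀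
  have hfin : IsFiniteMeasure (s • (ν₀ : Measure K).map Subtype.val) :=
    Measure.smul_finite _ hst
  have hKc : (s • (ν₀ : Measure K).map Subtype.val) Kᶜ = 0 := by
    rw [Measure.smul_apply, Measure.map_apply measurable_subtype_coe hK.measurableSet.compl]
    simp
  have henergy : regEnergy α q 𝒟 η (s • (ν₀ : Measure K).map Subtype.val) ≤ 1 := by
    rw [hG.regEnergy_smul hη α hq, hs, ENNReal.rpow_inv_rpow hp0.ne']
    calc _ ≤ (D * B)⁻¹ * (D * B) := by gcongr
      _ = 1 := ENNReal.inv_mul_cancel hDB0 hDBt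
  have hsle : s ^ q ≤ dyadicCapacity α q 𝒟 η K := by
    unfold dyadicCapacity
    gcongr
    refine le_iSup_of_le (s • (ν₀ : Measure K).map Subtype.val) (le_iSup_of_le inferInstance
      (le_iSup_of_le hKc (le_iSup_of_le henergy ?_)))
    simp
  -- Because `q / p = q - 1`, `s^q = (D * B)^(1-q)`, and `B^(1-q) = X`.
  have hsq : D ^ (q - 1) * s ^ q = X := by
    rw [hs, ← ENNReal.rpow_mul (D * B)⁻¹, show p⁻¹ * q = q - 1 by rw [hpq]; field_simp, ENNReal.inv_rpow,
      ENNReal.mul_rpow_of_nonneg _ _ hq1.le, hB, ENNReal.rpow_inv_rpow hq1.ne',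
      ENNReal.mul_inv (Or.inr (ENNReal.inv_ne_top.2 hX0)) (Or.inr (ENNReal.inv_ne_zero.2 hXt)),
      inv_inv, ← mul_assoc, ENNReal.mul_inv_cancel, one_mul]
    · simp [ENNReal.rpow_eq_zero_iff, hD0, hq1.not_gt]
    · exact ENNReal.rpow_ne_top_of_nonneg hq1.le hDt
  calc besselCapacity α q K = ((c : ℝ≥0∞) ^ q)⁻¹ * X := by
        rw [hX, mul_comm, mul_assoc, ENNReal.mul_inv_cancel hcq0 hcqt, mul_one]
    _ = ((c : ℝ≥0∞) ^ q)⁻¹ * (D ^ (q - 1) * s ^ q) := by rw [hsq]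
    _ ≤ ((c : ℝ≥0∞) ^ q)⁻¹ * (D ^ (q - 1) * dyadicCapacity α q 𝒟 η K) := by gcongr
    _ = _ := by ring

/-- An inequality between energies bounds the dyadic capacity by the Bessel capacity. -/
theorem dyadicCapacity_le_of_besselEnergy_le {d : ℕ} {α q : ℝ} (hq : 1 < q) {C : ℝ≥0}
    {𝒟 : Set (BackwardRect d)} {η : BackwardRect d → SpaceTime d → ℝ} {K : Set (SpaceTime d)}
    (hK : IsCompact K) (hC : ∀ μ : Measure (SpaceTime d), IsLocallyFiniteMeasure μ → μ Kᶜ = 0 →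
      besselEnergy α q μ ≤ C * regEnergy α q 𝒟 η μ) :
    dyadicCapacity α q 𝒟 η K ≤ ((C : ℝ≥0∞) + 1) ^ (q - 1) * besselCapacity α q K := by
  have hq0 : 0 < q := by linarith
  have hp := one_lt_conjExp hq
  -- The `+ 1` keeps `M` nonzero, so it can be divided out before taking the infimum over test
  -- functions.
  set M : ℝ≥0∞ := ((C : ℝ≥0∞) + 1) ^ (q - 1) with hM
  have hM0 : M ≠ 0 := by simp [hM, ENNReal.rpow_eq_zero_iff]
  have hMt : M ≠ ⊤ := ENNReal.rpow_ne_top_of_nonneg (by linarith) (by simp)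
  rw [mul_comm, ← ENNReal.div_le_iff_le_mul (Or.inl hM0) (Or.inl hMt)]
  refine le_iInf fun f => le_iInf fun hfp => le_iInf fun hf => le_iInf fun hfK => ?_
  rw [ENNReal.div_le_iff_le_mul (Or.inl hM0) (Or.inl hMt), dyadicCapacity,
    ← ENNReal.le_rpow_inv_iff hq0]
  refine iSup_le fun μ => iSup_le fun hμ => iSup_le fun hμK => iSup_le fun hμE => ?_
  refine (measure_univ_le_of_bessel hq hK hμK hfp.1 hf hfK).trans ?_
  rw [ENNReal.mul_rpow_of_nonneg _ _ (by positivity), one_div]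
  gcongr
  rw [hM, ← ENNReal.rpow_mul]
  have h1 : 1 / conjExp q = (q - 1) * q⁻¹ := by rw [conjExp]; field_simp
  rw [← h1]
  gcongr
  calc besselEnergy α q μ ≤ C * 1 := (hC μ hμ hμK).trans (by gcongr)
    _ ≤ C + 1 := by simp

end ParabolicWolff

/-! ### Assembly of the comparisons with one constant -/

theorem lemma3p5 (d : ℕ) (hd : 2 ≤ d) (α q : ℝ) (hα : 0 < α) (hαn : α < (d : ℝ) + 2)
    (hq : 1 < q) (hqn : q ≤ ((d : ℝ) + 2) / α) :
    ∃ C : ℝ≥0, ∀ (U : Set (SpaceTime d)), {z : SpaceTime d | 0 < z.2} ⊆ U →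
      ∀ (𝒟 : Set (BackwardRect d)), IsDyadicLattice U 𝒟 →
      ∀ (η : BackwardRect d → SpaceTime d → ℝ), (∀ R ∈ 𝒟, IsCutoff R (η R)) →
        (∀ μ : Measure (SpaceTime d), IsLocallyFiniteMeasure μ → μ Uᶜ = 0 →
          (dyadicEnergy α q 𝒟 μ ≤ C * regEnergy α q 𝒟 η μ ∧
            regEnergy α q 𝒟 η μ ≤ C * dyadicEnergy α q 𝒟 μ) ∧
          (regEnergy α q 𝒟 η μ ≤ C * besselEnergy α q μ ∧
            besselEnergy α q μ ≤ C * regEnergy α q 𝒟 η μ)) ∧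
        (∀ K : Set (SpaceTime d), IsCompact K → K ⊆ U →
          dyadicCapacity α q 𝒟 η K ≤ C * besselCapacity α q K ∧
            besselCapacity α q K ≤ C * dyadicCapacity α q 𝒟 η K) := by
  have hp := one_lt_conjExp hq
  obtain ⟨C₁, hC₁⟩ := exists_lintegral_nbhdPotential_le d hα hp
  obtain ⟨C₂, hC₂⟩ := exists_besselEnergy_le d hα hαn hp
  obtain ⟨C₃, hC₃⟩ := exists_wolffEnergy_le d hα hαn hp
  obtain ⟨C₄, hC₄⟩ := exists_besselCapacity_le_dyadicCapacity d hα hαn hq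
  set D : ℝ≥0 := ((box d 9).card : ℝ≥0) ^ conjExp q with hD
  have hDcoe : ((box d 9).card : ℝ≥0∞) ^ conjExp q = D := by
    rw [hD, ENNReal.coe_rpow_of_nonneg _ (by linarith)]; simp
  set C₅ : ℝ≥0 := (C₂ + 1) ^ (q - 1) with hC₅
  have hC₅coe : ((C₂ : ℝ≥0∞) + 1) ^ (q - 1) = C₅ := by
    rw [hC₅, ENNReal.coe_rpow_of_nonneg _ (by linarith)]; simp
  set C : ℝ≥0 := C₁ + C₂ + D + D * C₃ + C₄ + C₅ with hC
  have h₁ : C₁ ≤ C := by rw [hC]; simp only [add_assoc]; exact le_self_add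
  have h₂ : C₂ ≤ C := hC ▸ le_add_right (le_add_right (le_add_right (le_add_right le_add_self)))
  have h₃ : D ≤ C := hC ▸ le_add_right (le_add_right (le_add_right le_add_self))
  have h₄ : D * C₃ ≤ C := hC ▸ le_add_right (le_add_right le_add_self)
  have h₅ : C₄ ≤ C := hC ▸ le_add_right le_add_self
  have h₆ : C₅ ≤ C := hC ▸ le_add_self
  have mono : ∀ {a b : ℝ≥0} {x : ℝ≥0∞}, a ≤ b → (a : ℝ≥0∞) * x ≤ b * x := fun h =>
    mul_le_mul_left (ENNReal.coe_le_coe.2 h) _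
  refine ⟨C, fun U hU 𝒟 h𝒟 η hη => ?_⟩
  obtain ⟨G, hG⟩ := h𝒟.exists_fits hU
  have hbessel : ∀ μ : Measure (SpaceTime d), IsLocallyFiniteMeasure μ → μ Uᶜ = 0 →
      besselEnergy α q μ ≤ C₂ * regEnergy α q 𝒟 η μ := fun μ _ hμU =>
    (hC₂ G μ).trans (mul_le_mul_right (hG.wolffEnergy_le_regEnergy hμU hη α hq) _)
  refine ⟨fun μ hμ hμU => ⟨⟨?_, ?_⟩, ?_, ?_⟩, fun K hK hKU => ⟨?_, ?_⟩⟩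
  · refine ((hG.dyadicEnergy_le hμU α hq).trans (hC₁ G μ)).trans ?_
    exact (mul_le_mul_right (hG.wolffEnergy_le_regEnergy hμU hη α hq) _).trans (mono h₁)
  · refine (hG.regEnergy_le_wolffEnergy hη α hq).trans ?_
    rw [hDcoe]
    exact (mul_le_mul_right (hG.wolffEnergy_le_dyadicEnergy hμU α hq) _).trans (mono h₃)
  · refine (hG.regEnergy_le_wolffEnergy hη α hq).trans ?_
    rw [hDcoe]
    refine (mul_le_mul_right (hC₃ G μ) _).trans ?_
    rw [← mul_assoc, ← ENNReal.coe_mul]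
    exact mono h₄
  · exact (hbessel μ hμ hμU).trans (mono h₂)
  · refine (dyadicCapacity_le_of_besselEnergy_le hq hK fun μ hμ hμK => hbessel μ hμ
      (measure_mono_null (compl_subset_compl.2 hKU) hμK)).trans ?_
    rw [hC₅coe]
    exact mono h₆
  · exact (hC₄ G U 𝒟 hG η hη K hK).trans (mono h₅)
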